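/- All graphs are finite, simple and undirected. For a set $S$ of vertices of $G$, $N(S)$ is the set of vertices outside $S$ that have a neighbour in $S$; $S$ is connected if $G[S]$ is connected (and $S\neq\emptyset$); two sets of vertices are adjacent if some edge has one endpoint in each. An ordered $r$-partition of a set $A$ is a list of $r$ pairwise disjoint, possibly empty, subsets of $A$ whose union is $A$. An $r$-slab in $G$ is an ordered $r$-partition $\langle A_1,\dots,A_r\rangle$ of a connected set $A\subseteq V(G)$ such that (i) every $A_i$ is non-empty and connected; (ii) for $i\ne j$, $A_i$ and $A_j$ are adjacent if and only if $|i-j|=1$; (iii) with $B_i=N(A_i)\setminus A$, for $i\neq j$ the sets $B_i,B_j$ are disjoint, and if they are adjacent then $|i-j|=1$. It is an $(\alpha,\beta)$-$r$-slab if $|A|\le\alpha$ and $|N(A)|\le\beta$. An ordered $r$-partition $\mathcal P_r(Q)=\{Q_1,\dots,Q_r\}$ of $Q\subseteq V(G)$ is valid if adjacent vertices $u\in Q_i$, $v\in Q_j$ always satisfy $|i-j|\le1$; a $(\mathcal P_r(Q),\alpha,\beta)$-$r$-slab is an $(\alpha,\beta)$-$r$-slab $\langle A_1,\dots,A_r\rangle$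 with $Q_i\subseteq A_i$ for all $i$, where $\mathcal P_r(Q)$ is valid (if it is not valid there are none). Algorithms are programs of a random access machine with integer registers and memory, whose operations are addition, subtraction, comparison, indirect memory access and output, each of unit cost. (a) There is an algorithm that, given a graph $G$ on $n$ vertices, a non-empty set $Q\subseteq V(G)$, an ordered $r$-partition $\mathcal P_r(Q)$ of $Q$, and integers $\alpha,\beta$, enumerates all $(\mathcal P_r(Q),\alpha,\beta)$-$r$-slabs in $G$, each exactly once, in time $4^{\max\{0,\alpha-|Q|+\beta\}}\cdot n^{O(1)}$. (b) There is an algorithm that, given a graph $G$ on $n\geq 1$ vertices and integers $r\ge 0,\alpha,\beta$, enumerates all $(\alpha,\beta)$-$r$-slabs in $G$, each exactly once, in time $4^{\max\{0,\alpha+\beta\}}\cdot n^{O(1)}$. Here $n^{O(1)}$ means at most $C\cdot n^{c}$ steps with constants $C,c$ that depend on nothing (in particular not on $r$, $\alpha$, $\beta$). -/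

import Mathlib

namespace Slab

/-! ### Slabs in graphs -/

section Graph

variable {V : Type*} [Fintype V]

open Classical in
/-- The open neighbourhood `N(S)` of a set of vertices. -/
noncomputable def nbhd (G : SimpleGraph V) (S : Finset V) : Finset V :=
  Finset.univ.filter fun v => v ∉ S ∧ ∃ u ∈ S, G.Adj u v

/-- Two sets of vertices are adjacent if some edge has one endpoint in each of them. -/
def SetsAdj (G : SimpleGraph V) (S T : Finset V) : Prop :=
  ∃ u ∈ S, ∃ v ∈ T, G.Adj u v

/-- `S` is a connected set: the induced subgraph `G[S]` is connected (and nonempty). -/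
def ConnectedSet (G : SimpleGraph V) (S : Finset V) : Prop :=
  (G.induce (S : Set V)).Connected

/-- `|i - j| = 1` for indices. -/
def Consecutive {r : ℕ} (i j : Fin r) : Prop :=
  |(i : ℤ) - (j : ℤ)| = 1

open Classical in
/-- The union of the parts of a family. -/
noncomputable def parts {r : ℕ} (A : Fin r → Finset V) : Finset V :=
  Finset.univ.biUnion A

/-- `P` is an ordered `r`-partition of `Q` (parts may be empty). -/
def IsOrderedPartition {r : ℕ} (Q : Finset V) (P : Fin r → Finset V) : Prop :=
  (∀ i j, i ≠ j → Disjoint (P i) (P j)) ∧ parts P = Q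

/-- An ordered partition is valid if adjacent vertices lie in parts whose indices differ
by at most one. -/
def IsValid (G : SimpleGraph V) {r : ℕ} (P : Fin r → Finset V) : Prop :=
  ∀ i j, ∀ u ∈ P i, ∀ v ∈ P j, G.Adj u v → |(i : ℤ) - (j : ℤ)| ≤ 1

open Classical in
/-- `B_i = N(A_i) \ A`. -/
noncomputable def outerNbhd (G : SimpleGraph V) {r : ℕ} (A : Fin r → Finset V) (i : Fin r) :
    Finset V :=
  nbhd G (A i) \ parts A

/-- `⟨A_1, …, A_r⟩` is an `r`-slab of `G`. -/
structure IsSlab (G : SimpleGraph V) {r : ℕ} (A : Fin r → Finset V) : Prop where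
  partition : IsOrderedPartition (parts A) A
  connected : ConnectedSet G (parts A)
  part_nonempty : ∀ i, (A i).Nonempty
  part_connected : ∀ i, ConnectedSet G (A i)
  adj_iff : ∀ i j, i ≠ j → (SetsAdj G (A i) (A j) ↔ Consecutive i j)
  outer_disjoint : ∀ i j, i ≠ j → Disjoint (outerNbhd G A i) (outerNbhd G A j)
  outer_adj : ∀ i j, i ≠ j → SetsAdj G (outerNbhd G A i) (outerNbhd G A j) → Consecutive i j

/-- `(α, β)`-`r`-slabs. -/
def IsBoundedSlab (G : SimpleGraph V) {r : ℕ} (α β : ℤ) (A : Fin r → Finset V) : Prop :=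
  IsSlab G A ∧ ((parts A).card : ℤ) ≤ α ∧ ((nbhd G (parts A)).card : ℤ) ≤ β

/-- `P_r(Q)`-`r`-slabs, for a valid ordered partition `P`. -/
def IsExtendingSlab (G : SimpleGraph V) {r : ℕ} (P A : Fin r → Finset V) : Prop :=
  IsValid G P ∧ IsSlab G A ∧ ∀ i, P i ⊆ A i

/-- `(P_r(Q), α, β)`-`r`-slabs. -/
def IsBoundedExtendingSlab (G : SimpleGraph V) {r : ℕ} (P : Fin r → Finset V) (α β : ℤ)
    (A : Fin r → Finset V) : Prop :=
  IsBoundedSlab G α β A ∧ IsExtendingSlab G P A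

end Graph

/-! ### A random access machine

Integer registers, an integer-addressed memory, an output tape that is only appended to, and
programs with structured control flow. Arithmetic is restricted to addition and subtraction, and
every operation, memory access and test costs one step. -/

/-- Arithmetic expressions: constants, registers, indirect memory access, sum, difference. -/
inductive Expr : Type
  | const (z : ℤ)
  | reg (i : ℕ)
  | load (addr : Expr)
  | add (e₁ e₂ : Expr)
  | sub (e₁ e₂ : Expr)

/-- Tests. -/
inductive Test : Type
  | le (e₁ e₂ : Expr)
  | eq (e₁ e₂ : Expr)

/-- Programs. -/
inductive Prog : Type
  | skip
  | assign (i : ℕ) (e : Expr)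
  | store (addr e : Expr)
  | write (e : Expr)
  | seq (p q : Prog)
  | ite (b : Test) (p q : Prog)
  | while (b : Test) (p : Prog)

/-- Machine states: registers, memory, and what has been output so far. -/
structure State : Type where
  reg : ℕ → ℤ
  mem : ℤ → ℤ
  out : List ℤ

/-- The value of an expression. -/
def Expr.eval (s : State) : Expr → ℤ
  | .const z => z
  | .reg i => s.reg i
  | .load a => s.mem (a.eval s)
  | .add e₁ e₂ => e₁.eval s + e₂.eval s
  | .sub e₁ e₂ => e₁.eval s - e₂.eval s

/-- The number of steps for evaluating an expression. -/
def Expr.cost : Expr → ℕ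
  | .const _ => 1
  | .reg _ => 1
  | .load a => a.cost + 1
  | .add e₁ e₂ => e₁.cost + e₂.cost + 1
  | .sub e₁ e₂ => e₁.cost + e₂.cost + 1

/-- A test succeeds in a state. -/
def Test.Holds (s : State) : Test → Prop
  | .le e₁ e₂ => e₁.eval s ≤ e₂.eval s
  | .eq e₁ e₂ => e₁.eval s = e₂.eval s

/-- The number of steps for evaluating a test. -/
def Test.cost : Test → ℕ
  | .le e₁ e₂ => e₁.cost + e₂.cost + 1
  | .eq e₁ e₂ => e₁.cost + e₂.cost + 1

/-- `Exec p s s' t`: started in state `s`, program `p` halts in state `s'` after exactly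
`t` steps. -/
inductive Exec : Prog → State → State → ℕ → Prop
  | skip (s : State) : Exec .skip s s 1
  | assign (s : State) (i : ℕ) (e : Expr) :
      Exec (.assign i e) s { s with reg := Function.update s.reg i (e.eval s) } (e.cost + 1)
  | store (s : State) (a e : Expr) :
      Exec (.store a e) s { s with mem := Function.update s.mem (a.eval s) (e.eval s) }
        (a.cost + e.cost + 1)
  | write (s : State) (e : Expr) :
      Exec (.write e) s { s with out := s.out ++ [e.eval s] } (e.cost + 1)
  | seq {p q : Prog} {s s₁ s₂ : State} {t₁ t₂ : ℕ} :
      Exec p s s₁ t₁ → Exec q s₁ s₂ t₂ → Exec (.seq p q) s s₂ (t₁ + t₂)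
  | ite_true {b : Test} {p q : Prog} {s s' : State} {t : ℕ} :
      b.Holds s → Exec p s s' t → Exec (.ite b p q) s s' (b.cost + t)
  | ite_false {b : Test} {p q : Prog} {s s' : State} {t : ℕ} :
      ¬ b.Holds s → Exec q s s' t → Exec (.ite b p q) s s' (b.cost + t)
  | while_done {b : Test} {p : Prog} {s : State} :
      ¬ b.Holds s → Exec (.while b p) s s b.cost
  | while_step {b : Test} {p : Prog} {s s₁ s₂ : State} {t₁ t₂ : ℕ} :
      b.Holds s → Exec p s s₁ t₁ → Exec (.while b p) s₁ s₂ t₂ →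
      Exec (.while b p) s s₂ (b.cost + t₁ + t₂)

/-! ### Input and output conventions -/

/-- The label of a vertex with respect to pairwise disjoint sets `A_1, …, A_r`: it is `i` for the
vertices of `A_i` (so labels start at 1) and `0` for the vertices outside all of the sets. -/
def label {n r : ℕ} (A : Fin r → Finset (Fin n)) (v : Fin n) : ℤ :=
  ∑ i, if v ∈ A i then (i : ℤ) + 1 else 0

open Classical in
/-- Initial memory: cell `v` holds the label `lab v`, cell `n * (u + 1) + v` holds the entry
`(u, v)` of the adjacency matrix, for `u, v < n`, and all other cells hold `0`. -/
noncomputable def inputMem {n : ℕ} (G : SimpleGraph (Fin n)) (lab : Fin n → ℤ) (a : ℤ) : ℤ :=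
  if h : 0 ≤ a ∧ a.toNat < (n + 1) * n then
    let q : Fin (n + 1) × Fin n := finProdFinEquiv.symm ⟨a.toNat, h.2⟩
    Fin.cases (lab q.2) (fun u => if G.Adj u q.2 then 1 else 0) q.1
  else 0

theorem inputMem_label {n : ℕ} (G : SimpleGraph (Fin n)) (lab : Fin n → ℤ) (v : Fin n) :
    inputMem G lab v = lab v := by
  have key : ((v : ℕ) : ℤ).toNat = (finProdFinEquiv ((0 : Fin (n + 1)), v) : ℕ) := by
    simp [finProdFinEquiv]
  have h : 0 ≤ ((v : ℕ) : ℤ) ∧ ((v : ℕ) : ℤ).toNat < (n + 1) * n :=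
    ⟨by positivity, by rw [key]; exact Fin.isLt _⟩
  have e : (⟨((v : ℕ) : ℤ).toNat, h.2⟩ : Fin ((n + 1) * n))
      = finProdFinEquiv ((0 : Fin (n + 1)), v) := Fin.ext key
  unfold inputMem
  rw [dif_pos h, e, Equiv.symm_apply_apply]
  rfl

open Classical in
theorem inputMem_adj {n : ℕ} (G : SimpleGraph (Fin n)) (lab : Fin n → ℤ) (u v : Fin n) :
    inputMem G lab ((n : ℤ) * ((u : ℕ) + 1) + (v : ℕ)) = if G.Adj u v then 1 else 0 := by
  have key : ((n : ℤ) * ((u : ℕ) + 1) + (v : ℕ)).toNat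
      = (finProdFinEquiv (u.succ, v) : ℕ) := by
    have : ((n : ℤ) * ((u : ℕ) + 1) + (v : ℕ)) = ((n * ((u : ℕ) + 1) + (v : ℕ) : ℕ) : ℤ) := by
      push_cast; ring
    rw [this, Int.toNat_natCast]
    simp [finProdFinEquiv, add_comm]
  have h : 0 ≤ ((n : ℤ) * ((u : ℕ) + 1) + (v : ℕ)) ∧
      ((n : ℤ) * ((u : ℕ) + 1) + (v : ℕ)).toNat < (n + 1) * n :=
    ⟨by positivity, by rw [key]; exact Fin.isLt _⟩
  have e : (⟨((n : ℤ) * ((u : ℕ) + 1) + (v : ℕ)).toNat, h.2⟩ : Fin ((n + 1) * n))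
      = finProdFinEquiv (u.succ, v) := Fin.ext key
  unfold inputMem
  rw [dif_pos h, e, Equiv.symm_apply_apply]
  rfl

/-- Initial state: registers 0, 1, 2, 3 hold `n`, `r`, `α`, `β`, all other registers hold `0`,
the memory holds the labels and the adjacency matrix, and nothing has been output. -/
noncomputable def inputState {n : ℕ} (G : SimpleGraph (Fin n)) (r : ℕ) (lab : Fin n → ℤ)
    (α β : ℤ) : State where
  reg k := if k = 0 then n else if k = 1 then r else if k = 2 then α else if k = 3 then β else 0
  mem := inputMem G lab
  out := []

/-- One family `⟨A_1, …, A_r⟩` of disjoint sets is output as the list of the labels of the vertices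
`0, …, n - 1`. -/
def encode {n r : ℕ} (A : Fin r → Finset (Fin n)) : List ℤ :=
  List.ofFn (label A)

/-- Started in state `s`, program `p` halts within `T` steps, and its output is a listing without
repetition of exactly the families `A` with `S A`, one after the other. -/
def EnumeratesInTime {n r : ℕ} (p : Prog) (s : State) (S : (Fin r → Finset (Fin n)) → Prop)
    (T : ℕ) : Prop :=
  ∃ (s' : State) (t : ℕ) (L : List (Fin r → Finset (Fin n))),
    Exec p s s' t ∧ t ≤ T ∧ L.Nodup ∧ (∀ A, A ∈ L ↔ S A) ∧ s'.out = L.flatMap encode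

end Slab

/-! The slabs are found by branching. A partial slab is a labelling σ of the vertices: positive
values are part numbers, negative values mean excluded, 0 means undecided; initially Q carries its
given labels. Pick the first undecided vertex v with a neighbour in some part, and let i be the
least number of a part adjacent to v. In a slab A that agrees with σ, either v lies outside A, or v
lies in part i − 1, i or i + 1, because other parts are not adjacent to part i. This gives four
branches. Every picked vertex lies in A ∪ N(A) but not in Q, so at most |A| − |Q| + |N(A)| ≤ α − |Q|
+ β decisions lead to A; and if no vertex can be picked, connectedness of A shows that all of A has
been found.

Instead of recursing, the algorithm runs through all w < 4^D, where D is the minimum of n and max(0,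
α − |Q| + β), and reads w as D base-4 digits, the most significant one first. For each w it follows
the decisions and then tests in polynomial time whether the labelling is a slab within the bounds.
Completeness is `exists_decisions`; correctness of the test is `Good.isBoundedSlab` and
`IsBoundedSlab.good`, with connectivity decided by a marking procedure (`forall_marks_iff`). There
are no repetitions (`rem_close_of_result_eq`): once nothing can be picked, only the digit 0 is
accepted, so two accepted sequences first differ at a picked vertex, which then receives different
values that never change. Hence nothing already output has to be remembered.

For all slabs, the seed is a single vertex v in the first part, for every v, and a result is kept
only if v is the least vertex of its first part. So each slab arises from exactly one v.

On the machine side, everything but one loop is written with terms that allow sums over 0, …, n − 1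
and statements that allow loops over 0, …, n − 1. Their compiled programs are correct (`Term.runs`,
`Stmt.runs`) and have polynomial cost by structural induction (`Stmt.polyBounded_cost`). The loop
over w (`longLoop`) contributes the factor 4^D. -/

namespace Slab

/-! ### Hoare-style rules with a time bound -/

/-- Started in `s`, program `p` halts within `T` steps in a state satisfying `R`. -/
def Runs (p : Prog) (s : State) (R : State → Prop) (T : ℕ) : Prop :=
  ∃ s' t, Exec p s s' t ∧ t ≤ T ∧ R s'

namespace Runs

theorem mono {p : Prog} {s : State} {R R' : State → Prop} {T T' : ℕ}
    (h : Runs p s R T) (hR : ∀ s', R s' → R' s') (hT : T ≤ T') : Runs p s R' T' := by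
  obtain ⟨s', t, h1, h2, h3⟩ := h
  exact ⟨s', t, h1, h2.trans hT, hR _ h3⟩

theorem skip {s : State} {R : State → Prop} (h : R s) : Runs .skip s R 1 :=
  ⟨s, 1, .skip s, le_rfl, h⟩

theorem assign {s : State} {i : ℕ} {e : Expr} {R : State → Prop}
    (h : R { s with reg := Function.update s.reg i (e.eval s) }) :
    Runs (.assign i e) s R (e.cost + 1) :=
  ⟨_, _, .assign s i e, le_rfl, h⟩

theorem store {s : State} {a e : Expr} {R : State → Prop}
    (h : R { s with mem := Function.update s.mem (a.eval s) (e.eval s) }) :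
    Runs (.store a e) s R (a.cost + e.cost + 1) :=
  ⟨_, _, .store s a e, le_rfl, h⟩

theorem write {s : State} {e : Expr} {R : State → Prop}
    (h : R { s with out := s.out ++ [e.eval s] }) :
    Runs (.write e) s R (e.cost + 1) :=
  ⟨_, _, .write s e, le_rfl, h⟩

theorem seq {p q : Prog} {s : State} {R S : State → Prop} {T₁ T₂ : ℕ}
    (hp : Runs p s R T₁) (hq : ∀ s', R s' → Runs q s' S T₂) :
    Runs (.seq p q) s S (T₁ + T₂) := by
  obtain ⟨s', t, h1, h2, h3⟩ := hp
  obtain ⟨s'', t', h1', h2', h3'⟩ := hq s' h3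
  exact ⟨s'', t + t', .seq h1 h1', by omega, h3'⟩

theorem ite {b : Test} {p q : Prog} {s : State} {R : State → Prop} {T₁ T₂ : ℕ}
    (hp : b.Holds s → Runs p s R T₁) (hq : ¬ b.Holds s → Runs q s R T₂) :
    Runs (.ite b p q) s R (b.cost + T₁ + T₂) := by
  by_cases h : b.Holds s
  · obtain ⟨s', t, h1, h2, h3⟩ := hp h
    exact ⟨s', _, .ite_true h h1, by omega, h3⟩
  · obtain ⟨s', t, h1, h2, h3⟩ := hq h
    exact ⟨s', _, .ite_false h h1, by omega, h3⟩

end Runs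

/-- Repeat `p` and increment register `x` until `x` reaches the value of register `y`. -/
def countLoop (x y : ℕ) (p : Prog) : Prog :=
  .while (.le (.add (.reg x) (.const 1)) (.reg y))
    (.seq p (.assign x (.add (.reg x) (.const 1))))

/-- Besides the body, a round costs 5 for the test and 4 for the increment; the last, failing test
costs 5. The body has to leave the counter at j, and the invariant is required only after the
increment. -/
theorem Runs.countLoop {x y : ℕ} {p : Prog} {N T : ℕ} (I : ℕ → State → Prop)
    (hI : ∀ j s, I j s → s.reg x = j ∧ s.reg y = N)
    (hp : ∀ j s, j < N → I j s → Runs p s (fun s' => s'.reg x = j ∧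
      I (j + 1) { s' with reg := Function.update s'.reg x ((j + 1 : ℕ) : ℤ) }) T)
    {s : State} (h0 : I 0 s) :
    Runs (Slab.countLoop x y p) s (I N) (N * (T + 9) + 5) := by
  have key : ∀ d j s, j + d = N → I j s →
      Runs (Slab.countLoop x y p) s (I N) (d * (T + 9) + 5) := by
    intro d
    induction d with
    | zero =>
      intro j s hj hs
      obtain ⟨hx, hy⟩ := hI j s hs
      refine ⟨s, _, .while_done ?_, ?_, ?_⟩
      · simp only [Test.Holds, Expr.eval, hx, hy]
        omega
      · simp [Test.cost, Expr.cost]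
      · have : j = N := by omega
        exact this ▸ hs
    | succ d ih =>
      intro j s hj hs
      obtain ⟨hx, hy⟩ := hI j s hs
      obtain ⟨s₁, t₁, e₁, ht₁, hx₁, hI₁⟩ := hp j s (by omega) hs
      obtain ⟨s₂, t₂, e₂, ht₂, hI₂⟩ := ih (j + 1) _ (by omega) hI₁
      refine ⟨s₂, _, .while_step (t₂ := t₂) ?_ (.seq e₁ (.assign _ _ _)) ?_, ?_, hI₂⟩
      · simp only [Test.Holds, Expr.eval, hx, hy]
        omega
      · have : (Expr.add (.reg x) (.const 1)).eval s₁ = ((j + 1 : ℕ) : ℤ) := by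
          simp [Expr.eval, hx₁]
        rw [this]
        exact e₂
      · simp only [Test.cost, Expr.cost]
        have : (d + 1) * (T + 9) = d * (T + 9) + (T + 9) := by ring
        omega
  exact key N 0 s (by omega) h0

/-! ### Terms with bounded sums -/

/-- Registers below `userRegs` are program variables, the others are temporaries. -/
abbrev userRegs : ℕ := 32

/-- Terms: arithmetic, memory access, case distinction `a ≤ b`, and sums over `0, …, n - 1`. -/
inductive Term : Type
  | const (z : ℤ)
  | var (i : ℕ)
  | load (a : Term)
  | add (a b : Term)
  | sub (a b : Term)
  | ite (a b c d : Term)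
  | sum (x : ℕ) (t : Term)

namespace Term

/-- The value of a term. -/
def eval (n : ℕ) (m : ℤ → ℤ) : Term → (ℕ → ℤ) → ℤ
  | const z, _ => z
  | var i, ρ => ρ i
  | load a, ρ => m (a.eval n m ρ)
  | add a b, ρ => a.eval n m ρ + b.eval n m ρ
  | sub a b, ρ => a.eval n m ρ - b.eval n m ρ
  | ite a b c d, ρ => if a.eval n m ρ ≤ b.eval n m ρ then c.eval n m ρ else d.eval n m ρ
  | sum x t, ρ => ∑ j : Fin n, t.eval n m (Function.update ρ x ((j : ℕ) : ℤ))

/-- All variables are program variables, and register `0` is not bound. -/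
def ok : Term → Bool
  | const _ => true
  | var i => decide (i < userRegs)
  | load a => a.ok
  | add a b => a.ok && b.ok
  | sub a b => a.ok && b.ok
  | ite a b c d => a.ok && b.ok && c.ok && d.ok
  | sum x t => decide (0 < x) && decide (x < userRegs) && t.ok

/-- A program that puts the value of a term into register `k` and uses the registers from `k`
on as temporaries. -/
def comp : Term → ℕ → Prog
  | const z, k => .assign k (.const z)
  | var i, k => .assign k (.reg i)
  | load a, k => .seq (a.comp k) (.assign k (.load (.reg k)))
  | add a b, k => .seq (a.comp k) (.seq (b.comp (k + 1))
      (.assign k (.add (.reg k) (.reg (k + 1)))))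
  | sub a b, k => .seq (a.comp k) (.seq (b.comp (k + 1))
      (.assign k (.sub (.reg k) (.reg (k + 1)))))
  | ite a b c d, k => .seq (a.comp k) (.seq (b.comp (k + 1))
      (.ite (.le (.reg k) (.reg (k + 1))) (c.comp k) (d.comp k)))
  | sum x t, k => .seq (.assign k (.const 0)) (.seq (.assign (k + 1) (.reg x))
      (.seq (.assign x (.const 0)) (.seq
        (countLoop x 0 (.seq (t.comp (k + 2)) (.assign k (.add (.reg k) (.reg (k + 2))))))
        (.assign x (.reg (k + 1))))))

/-- A time bound for `Term.comp`. -/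
def cost (n : ℕ) : Term → ℕ
  | const _ => 2
  | var _ => 2
  | load a => a.cost n + 3
  | add a b => a.cost n + b.cost n + 4
  | sub a b => a.cost n + b.cost n + 4
  | ite a b c d => a.cost n + b.cost n + c.cost n + d.cost n + 3
  | sum _ t => n * (t.cost n + 13) + 13

theorem eval_congr {n : ℕ} {m : ℤ → ℤ} (t : Term) (ht : t.ok) {ρ ρ' : ℕ → ℤ}
    (h : ∀ i < userRegs, ρ i = ρ' i) : t.eval n m ρ = t.eval n m ρ' := by
  induction t generalizing ρ ρ' with
  | const z => rfl
  | var i => exact h i (by simpa [ok] using ht)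
  | load a iha => simp only [eval, iha ht h]
  | add a b iha ihb =>
    simp only [ok, Bool.and_eq_true] at ht
    simp only [eval, iha ht.1 h, ihb ht.2 h]
  | sub a b iha ihb =>
    simp only [ok, Bool.and_eq_true] at ht
    simp only [eval, iha ht.1 h, ihb ht.2 h]
  | ite a b c d iha ihb ihc ihd =>
    simp only [ok, Bool.and_eq_true] at ht
    simp only [eval, iha ht.1.1.1 h, ihb ht.1.1.2 h, ihc ht.1.2 h, ihd ht.2 h]
  | sum x t ih =>
    simp only [ok, Bool.and_eq_true] at ht
    simp only [eval]
    refine Finset.sum_congr rfl fun j _ => ih ht.2 fun i hi => ?_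
    by_cases hx : i = x
    · subst hx; simp
    · simp [hx, h i hi]

/-- Registers from k on are scratch space and all registers below k survive. A sum overwrites its
bound variable, but saves the old value in register k + 1 and restores it. Register 0 holds the
length of every sum, which is why it may not be bound. -/
theorem runs {n : ℕ} (t : Term) (ht : t.ok) {k : ℕ} (hk : userRegs ≤ k) {s : State}
    (hs : s.reg 0 = n) :
    Runs (t.comp k) s (fun s' => s'.mem = s.mem ∧ s'.out = s.out ∧
      (∀ i < k, s'.reg i = s.reg i) ∧ s'.reg k = t.eval n s.mem s.reg) (t.cost n) := by
  have frame : ∀ {s s' : State} {k : ℕ}, userRegs ≤ k → s.reg 0 = n →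
      (∀ i < k, s'.reg i = s.reg i) → s'.reg 0 = n := by
    intro s s' k hk h0 h
    rw [h 0 (by simp only [userRegs] at hk; omega), h0]
  have upd : ∀ {s s' : State} {k : ℕ} {z : ℤ}, (∀ i < k, s'.reg i = s.reg i) →
      ∀ i < k, (Function.update s'.reg k z) i = s.reg i := by
    intro s s' k z h i hi
    rw [Function.update_of_ne (by omega), h i hi]
  -- The second operand uses temporaries from k + 1 on, so the first value stays intact in register
  -- k.
  have bin : ∀ (a b : Term), a.ok → b.ok →
      (∀ {k : ℕ}, userRegs ≤ k → ∀ {s : State}, s.reg 0 = n →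
        Runs (a.comp k) s (fun s' => s'.mem = s.mem ∧ s'.out = s.out ∧
          (∀ i < k, s'.reg i = s.reg i) ∧ s'.reg k = a.eval n s.mem s.reg) (a.cost n)) →
      (∀ {k : ℕ}, userRegs ≤ k → ∀ {s : State}, s.reg 0 = n →
        Runs (b.comp k) s (fun s' => s'.mem = s.mem ∧ s'.out = s.out ∧
          (∀ i < k, s'.reg i = s.reg i) ∧ s'.reg k = b.eval n s.mem s.reg) (b.cost n)) →
      ∀ {k : ℕ}, userRegs ≤ k → ∀ {s : State}, s.reg 0 = n →
      ∀ {q : Prog} {R : State → Prop} {T : ℕ},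
      (∀ s', s'.mem = s.mem → s'.out = s.out → (∀ i < k, s'.reg i = s.reg i) →
        s'.reg k = a.eval n s.mem s.reg → s'.reg (k + 1) = b.eval n s.mem s.reg →
        Runs q s' R T) →
      Runs (.seq (a.comp k) (.seq (b.comp (k + 1)) q)) s R (a.cost n + (b.cost n + T)) := by
    intro a b ha hb iha ihb k hk s hs q R T hq
    refine (iha hk hs).seq fun s₁ h₁ => ?_
    refine (ihb (k := k + 1) (by omega) (frame hk hs h₁.2.2.1)).seq fun s₂ h₂ => ?_
    refine hq s₂ (h₂.1.trans h₁.1) (h₂.2.1.trans h₁.2.1) ?_ ?_ ?_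
    · intro i hi
      rw [h₂.2.2.1 i (by omega), h₁.2.2.1 i hi]
    · rw [h₂.2.2.1 k (by omega), h₁.2.2.2]
    · rw [h₂.2.2.2, h₁.1]
      exact eval_congr b hb fun i hi => h₁.2.2.1 i (by omega)
  induction t generalizing k s with
  | const z =>
    exact Runs.assign ⟨rfl, rfl, upd fun _ _ => rfl, by simp [Expr.eval, eval]⟩
  | var i =>
    exact Runs.assign ⟨rfl, rfl, upd fun _ _ => rfl, by simp [Expr.eval, eval]⟩
  | load a iha =>
    refine (iha ht hk hs).seq fun s₁ h₁ => Runs.assign ⟨h₁.1, h₁.2.1, upd h₁.2.2.1, ?_⟩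
    simp [Expr.eval, eval, h₁.2.2.2, h₁.1]
  | add a b iha ihb =>
    simp only [ok, Bool.and_eq_true] at ht
    refine (bin a b ht.1 ht.2 (iha ht.1) (ihb ht.2) hk hs (T := 4)
      fun s₁ h₁ h₂ h₃ h₄ h₅ => Runs.assign ⟨h₁, h₂, upd h₃, ?_⟩).mono (fun _ h => h) ?_
    · simp only [cost]; omega
    · simp [Expr.eval, eval, h₄, h₅]
  | sub a b iha ihb =>
    simp only [ok, Bool.and_eq_true] at ht
    refine (bin a b ht.1 ht.2 (iha ht.1) (ihb ht.2) hk hs (T := 4)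
      fun s₁ h₁ h₂ h₃ h₄ h₅ => Runs.assign ⟨h₁, h₂, upd h₃, ?_⟩).mono (fun _ h => h) ?_
    · simp only [cost]; omega
    · simp [Expr.eval, eval, h₄, h₅]
  | ite a b c d iha ihb ihc ihd =>
    simp only [ok, Bool.and_eq_true] at ht
    obtain ⟨⟨⟨ha, hb⟩, hc⟩, hd⟩ := ht
    refine (bin a b ha hb (iha ha) (ihb hb) hk hs (T := 3 + c.cost n + d.cost n)
      fun s₁ h₁ h₂ h₃ h₄ h₅ => Runs.ite (fun hb => ?_) (fun hb => ?_)).mono (fun _ h => h) ?_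
    · simp only [Test.Holds, Expr.eval, h₄, h₅] at hb
      refine (ihc hc hk (frame hk hs h₃)).mono (fun s₂ h => ?_) le_rfl
      refine ⟨h.1.trans h₁, h.2.1.trans h₂, fun i hi => (h.2.2.1 i hi).trans (h₃ i hi), ?_⟩
      simp only [eval, if_pos hb]
      rw [h.2.2.2, h₁]
      exact eval_congr c hc fun i hi => h₃ i (by omega)
    · simp only [Test.Holds, Expr.eval, h₄, h₅] at hb
      refine (ihd hd hk (frame hk hs h₃)).mono (fun s₂ h => ?_) le_rfl
      refine ⟨h.1.trans h₁, h.2.1.trans h₂, fun i hi => (h.2.2.1 i hi).trans (h₃ i hi), ?_⟩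
      simp only [eval, if_neg hb]
      rw [h.2.2.2, h₁]
      exact eval_congr d hd fun i hi => h₃ i (by omega)
    · simp only [cost]; omega
  | sum x t ih =>
    simp only [ok, Bool.and_eq_true, decide_eq_true_eq] at ht
    obtain ⟨⟨hx0, hxK⟩, ht⟩ := ht
    have hxk : x < k := lt_of_lt_of_le hxK hk
    have h0k : 0 < k := by omega
    let F : ℕ → ℤ := fun j => t.eval n s.mem (Function.update s.reg x (j : ℤ))
    let I : ℕ → State → Prop := fun j s' =>
      s'.mem = s.mem ∧ s'.out = s.out ∧ (∀ i < k, i ≠ x → s'.reg i = s.reg i) ∧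
      s'.reg x = j ∧ s'.reg (k + 1) = s.reg x ∧ s'.reg k = ∑ i ∈ Finset.range j, F i
    have hloop : ∀ s₁, I 0 s₁ →
        Runs (countLoop x 0 (.seq (t.comp (k + 2))
          (.assign k (.add (.reg k) (.reg (k + 2)))))) s₁ (I n)
          (n * ((t.cost n + 4) + 9) + 5) := by
      intro s₁ hs₁
      refine Runs.countLoop I (fun j s' h => ⟨h.2.2.2.1, ?_⟩) (fun j s' hj h => ?_) hs₁
      · rw [h.2.2.1 0 h0k (by omega), hs]
      · obtain ⟨hm, ho, hr, hx, hsv, hacc⟩ := h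
        refine (ih ht (k := k + 2) (by omega) (s := s')
          (by rw [hr 0 h0k (by omega), hs])).seq fun s₂ h₂ => Runs.assign ?_
        obtain ⟨hm₂, ho₂, hr₂, hk₂⟩ := h₂
        refine ⟨?_, hm₂.trans hm, ho₂.trans ho, ?_, ?_, ?_, ?_⟩
        · simp only
          rw [Function.update_of_ne (by omega), hr₂ x (by omega), hx]
        · intro i hi hix
          simp only
          rw [Function.update_of_ne hix, Function.update_of_ne (by omega), hr₂ i (by omega),
            hr i hi hix]
        · simp
        · simp only
          rw [Function.update_of_ne (by omega), Function.update_of_ne (by omega),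
            hr₂ _ (by omega), hsv]
        · simp only
          rw [Function.update_of_ne (by omega), Function.update_self]
          simp only [Expr.eval]
          rw [hr₂ k (by omega), hacc, hk₂, Finset.sum_range_succ, hm]
          congr 1
          refine eval_congr t ht fun i hi => ?_
          by_cases hix : i = x
          · subst hix; simp [hx]
          · rw [Function.update_of_ne hix, hr i (by omega) hix]
    have main := Runs.seq (Runs.assign (s := s) (i := k) (e := .const 0)
        (R := fun s₁ => s₁ = { s with reg := Function.update s.reg k 0 }) rfl)
      (fun s₁ h₁ => Runs.seq (Runs.assign (s := s₁) (i := k + 1) (e := .reg x)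
        (R := fun s₂ => s₂ = { s₁ with reg := Function.update s₁.reg (k + 1) (s₁.reg x) }) rfl)
      (fun s₂ h₂ => Runs.seq (Runs.assign (s := s₂) (i := x) (e := .const 0)
        (R := fun s₃ => s₃ = { s₂ with reg := Function.update s₂.reg x 0 }) rfl)
      (fun s₃ h₃ => Runs.seq (hloop s₃ ?_)
      (fun s₄ h₄ => Runs.assign (i := x) (e := .reg (k + 1)) (R := fun s' =>
        s'.mem = s.mem ∧ s'.out = s.out ∧ (∀ i < k, s'.reg i = s.reg i) ∧
          s'.reg k = (Term.sum x t).eval n s.mem s.reg) ?_))))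
    · refine main.mono (fun _ h => h) ?_
      simp only [cost, Expr.cost]
      have : n * (t.cost n + 4 + 9) = n * (t.cost n + 13) := by ring
      omega
    · subst h₃ h₂ h₁
      refine ⟨rfl, rfl, ?_, ?_, ?_, ?_⟩
      · intro i hi hix
        simp only
        rw [Function.update_of_ne hix, Function.update_of_ne (by omega),
          Function.update_of_ne (by omega)]
      · simp
      · simp only
        rw [Function.update_of_ne (by omega), Function.update_self,
          Function.update_of_ne (by omega)]
      · simp only
        rw [Function.update_of_ne (by omega), Function.update_of_ne (by omega),
          Function.update_self]
        simp
    · obtain ⟨hm, ho, hr, hx, hsv, hacc⟩ := h₄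
      refine ⟨hm, ho, ?_, ?_⟩
      · intro i hi
        simp only [Expr.eval]
        by_cases hix : i = x
        · subst hix; simp [hsv]
        · rw [Function.update_of_ne hix, hr i hi hix]
      · simp only [Expr.eval]
        rw [Function.update_of_ne (by omega), hacc]
        simp only [eval, F]
        rw [Finset.sum_range]

end Term

/-! ### Statements with counting loops -/

/-- Statements: loops run over `0, …, n - 1`, and conditions `t` hold if `1 ≤ t`. -/
inductive Stmt : Type
  | skip
  | assign (x : ℕ) (t : Term)
  | store (a t : Term)
  | write (t : Term)
  | seq (p q : Stmt)
  | cond (t : Term) (p q : Stmt)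
  | forn (x : ℕ) (p : Stmt)

/-- `f (n - 1) (… (f 0 s))`. -/
def iter (f : ℕ → State → State) : ℕ → State → State
  | 0, s => s
  | n + 1, s => f n (iter f n s)

/-- The state with register `x` set to `z`. -/
def State.setReg (s : State) (x : ℕ) (z : ℤ) : State :=
  { s with reg := Function.update s.reg x z }

theorem State.setReg_self (s : State) (x : ℕ) (z : ℤ) : (s.setReg x z).reg x = z := by
  simp [State.setReg]

theorem State.setReg_ne (s : State) {x i : ℕ} (z : ℤ) (h : i ≠ x) :
    (s.setReg x z).reg i = s.reg i := by
  simp [State.setReg, h]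

namespace Stmt

/-- The state after executing a statement. -/
def den (n : ℕ) : Stmt → State → State
  | skip, s => s
  | assign x t, s => s.setReg x (t.eval n s.mem s.reg)
  | store a t, s =>
    { s with mem := Function.update s.mem (a.eval n s.mem s.reg) (t.eval n s.mem s.reg) }
  | write t, s => { s with out := s.out ++ [t.eval n s.mem s.reg] }
  | seq p q, s => q.den n (p.den n s)
  | cond t p q, s => if 1 ≤ t.eval n s.mem s.reg then p.den n s else q.den n s
  | forn x p, s => iter (fun j s => p.den n (s.setReg x j)) n s

/-- All variables are program variables, and register `0` is not changed. -/
def ok : Stmt → Bool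
  | skip => true
  | assign x t => decide (0 < x) && decide (x < userRegs) && t.ok
  | store a t => a.ok && t.ok
  | write t => t.ok
  | seq p q => p.ok && q.ok
  | cond t p q => t.ok && p.ok && q.ok
  | forn x p => decide (0 < x) && decide (x < userRegs) && p.ok

/-- A program for a statement that uses the registers from `k` on as temporaries. -/
def comp : Stmt → ℕ → Prog
  | skip, _ => .skip
  | assign x t, k => .seq (t.comp k) (.assign x (.reg k))
  | store a t, k => .seq (a.comp k) (.seq (t.comp (k + 1)) (.store (.reg k) (.reg (k + 1))))
  | write t, k => .seq (t.comp k) (.write (.reg k))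
  | seq p q, k => .seq (p.comp k) (q.comp k)
  | cond t p q, k => .seq (t.comp k) (.ite (.le (.const 1) (.reg k)) (p.comp k) (q.comp k))
  | forn x p, k => .seq (.assign k (.const 0))
      (countLoop k 0 (.seq (.assign x (.reg k)) (p.comp (k + 1))))

/-- A time bound for `Stmt.comp`. -/
def cost (n : ℕ) : Stmt → ℕ
  | skip => 1
  | assign _ t => t.cost n + 2
  | store a t => a.cost n + t.cost n + 3
  | write t => t.cost n + 2
  | seq p q => p.cost n + q.cost n
  | cond t p q => t.cost n + p.cost n + q.cost n + 3
  | forn _ p => n * (p.cost n + 11) + 7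

/-- `k` is not the target of an assignment. -/
def keeps (k : ℕ) : Stmt → Bool
  | skip => true
  | assign x _ => decide (x ≠ k)
  | store _ _ => true
  | write _ => true
  | seq p q => p.keeps k && q.keeps k
  | cond _ p q => p.keeps k && q.keeps k
  | forn x p => decide (x ≠ k) && p.keeps k

/-- There are no outputs. -/
def silent : Stmt → Bool
  | skip => true
  | assign _ _ => true
  | store _ _ => true
  | write _ => false
  | seq p q => p.silent && q.silent
  | cond _ p q => p.silent && q.silent
  | forn _ p => p.silent

end Stmt

theorem iter_inv {f : ℕ → State → State} {n : ℕ} {s : State} (I : ℕ → State → Prop)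
    (h0 : I 0 s) (hs : ∀ j < n, ∀ s, I j s → I (j + 1) (f j s)) : I n (iter f n s) := by
  have : ∀ k ≤ n, I k (iter f k s) := by
    intro k
    induction k with
    | zero => exact fun _ => h0
    | succ k ih => exact fun hk => hs k hk _ (ih (by omega))
  exact this n le_rfl

namespace Stmt

theorem den_forn_inv {n x : ℕ} {p : Stmt} {s : State} (I : ℕ → State → Prop)
    (h0 : I 0 s) (hs : ∀ j < n, ∀ s, I j s → I (j + 1) (p.den n (s.setReg x j))) :
    I n ((forn x p).den n s) :=
  iter_inv I h0 hs

theorem den_reg {n k : ℕ} {p : Stmt} (h : p.keeps k) (s : State) :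
    (p.den n s).reg k = s.reg k := by
  induction p generalizing s with
  | skip => rfl
  | assign x t =>
    have : x ≠ k := by simpa [keeps] using h
    simp [den, State.setReg, Function.update_of_ne this.symm]
  | store a t => rfl
  | write t => rfl
  | seq p q ihp ihq =>
    simp only [keeps, Bool.and_eq_true] at h
    simp only [den, ihq h.2, ihp h.1]
  | cond t p q ihp ihq =>
    simp only [keeps, Bool.and_eq_true] at h
    simp only [den]
    split_ifs
    · exact ihp h.1 s
    · exact ihq h.2 s
  | forn x p ih =>
    simp only [keeps, Bool.and_eq_true, decide_eq_true_eq] at h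
    refine den_forn_inv (fun _ s' => s'.reg k = s.reg k) rfl fun j _ s' hs' => ?_
    rw [ih h.2]
    simp [State.setReg, Function.update_of_ne h.1.symm, hs']

theorem den_out {n : ℕ} {p : Stmt} (h : p.silent) (s : State) :
    (p.den n s).out = s.out := by
  induction p generalizing s with
  | skip => rfl
  | assign x t => rfl
  | store a t => rfl
  | write t => simp [silent] at h
  | seq p q ihp ihq =>
    simp only [silent, Bool.and_eq_true] at h
    simp only [den, ihq h.2, ihp h.1]
  | cond t p q ihp ihq =>
    simp only [silent, Bool.and_eq_true] at h
    simp only [den]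
    split_ifs
    · exact ihp h.1 s
    · exact ihq h.2 s
  | forn x p ih =>
    exact den_forn_inv (fun _ s' => s'.out = s.out) rfl fun j _ s' hs' => by
      rw [ih h]; exact hs'

end Stmt

/-- Two states agree except for temporaries. -/
def State.Agree (s σ : State) : Prop :=
  (∀ i < userRegs, s.reg i = σ.reg i) ∧ s.mem = σ.mem ∧ s.out = σ.out

namespace Stmt

theorem keeps_zero {p : Stmt} (h : p.ok) : p.keeps 0 := by
  induction p with
  | skip | store | write => rfl
  | assign x t =>
    simp only [ok, Bool.and_eq_true, decide_eq_true_eq] at h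
    simp only [keeps, decide_eq_true_eq]
    omega
  | seq p q ihp ihq =>
    simp only [ok, Bool.and_eq_true] at h
    simp [keeps, ihp h.1, ihq h.2]
  | cond t p q ihp ihq =>
    simp only [ok, Bool.and_eq_true] at h
    simp [keeps, ihp h.1.2, ihq h.2]
  | forn x p ih =>
    simp only [ok, Bool.and_eq_true, decide_eq_true_eq] at h
    simp only [keeps, ih h.2, Bool.and_true, decide_eq_true_eq]
    omega

theorem runs_term {n : ℕ} {t : Term} (ht : t.ok) {k : ℕ} (hk : userRegs ≤ k) {s σ : State}
    (hs : s.Agree σ) (h0 : σ.reg 0 = n) :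
    Runs (t.comp k) s (fun s' => s'.Agree σ ∧ (∀ i < k, s'.reg i = s.reg i) ∧
      s'.reg k = t.eval n σ.mem σ.reg) (t.cost n) := by
  refine (t.runs ht hk (n := n) (s := s) (by rw [hs.1 0 (by decide), h0])).mono
    (fun s' h => ?_) le_rfl
  obtain ⟨hm, ho, hr, hv⟩ := h
  refine ⟨⟨fun i hi => (hr i (by omega)).trans (hs.1 i hi), hm.trans hs.2.1,
    ho.trans hs.2.2⟩, hr, ?_⟩
  rw [hv, hs.2.1]
  exact Term.eval_congr t ht hs.1

/-- The clause on registers between `userRegs` and k protects the counters of enclosing loops: a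
loop counts in register k, hands the registers from k + 1 on to its body and copies the counter into
x. Thus assignments to x in the body cannot affect the number of rounds. -/
theorem runs {n : ℕ} (p : Stmt) (hp : p.ok) {k : ℕ} (hk : userRegs ≤ k) {s σ : State}
    (hs : s.Agree σ) (h0 : σ.reg 0 = n) :
    Runs (p.comp k) s (fun s' => s'.Agree (p.den n σ) ∧
      ∀ i < k, userRegs ≤ i → s'.reg i = s.reg i) (p.cost n) := by
  induction p generalizing k s σ with
  | skip => exact Runs.skip ⟨hs, fun _ _ _ => rfl⟩
  | assign x t =>
    simp only [ok, Bool.and_eq_true, decide_eq_true_eq] at hp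
    refine (runs_term hp.2 hk hs h0).seq fun s₁ h₁ => Runs.assign ⟨⟨?_, h₁.1.2.1, h₁.1.2.2⟩, ?_⟩
    · intro i hi
      simp only [den, State.setReg, Expr.eval, h₁.2.2]
      by_cases hx : i = x
      · subst hx; simp
      · simp [hx, h₁.1.1 i hi]
    · intro i hi hi'
      simp only
      rw [Function.update_of_ne (by omega), h₁.2.1 i hi]
  | store a t =>
    simp only [ok, Bool.and_eq_true] at hp
    refine ((runs_term hp.1 hk hs h0).seq fun s₁ h₁ => (runs_term hp.2 (k := k + 1) (by omega)
      h₁.1 h0).seq fun s₂ h₂ => Runs.store ⟨⟨h₂.1.1, ?_, h₂.1.2.2⟩, ?_⟩).mono (fun _ h => h) ?_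
    · simp only [cost, Expr.cost]; omega
    · simp only [den, Expr.eval]
      rw [h₂.2.1 k (by omega), h₁.2.2, h₂.2.2, h₂.1.2.1]
    · intro i hi _
      simp only
      rw [h₂.2.1 i (by omega), h₁.2.1 i hi]
  | write t =>
    refine (runs_term hp hk hs h0).seq fun s₁ h₁ => Runs.write ⟨⟨h₁.1.1, h₁.1.2.1, ?_⟩, ?_⟩
    · simp only [den, Expr.eval, h₁.2.2, h₁.1.2.2]
    · intro i hi _
      exact h₁.2.1 i hi
  | seq p q ihp ihq =>
    simp only [ok, Bool.and_eq_true] at hp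
    refine (ihp hp.1 hk hs h0).seq fun s₁ h₁ => ?_
    have h0' : (p.den n σ).reg 0 = n := by rw [den_reg (keeps_zero hp.1), h0]
    refine (ihq hp.2 hk h₁.1 h0').mono (fun s₂ h₂ => ⟨h₂.1, fun i hi hi' => ?_⟩) le_rfl
    rw [h₂.2 i hi hi', h₁.2 i hi hi']
  | cond t p q ihp ihq =>
    simp only [ok, Bool.and_eq_true] at hp
    refine ((runs_term hp.1.1 hk hs h0).seq fun s₁ h₁ => Runs.ite (T₁ := p.cost n)
      (T₂ := q.cost n) (fun hb => ?_) (fun hb => ?_)).mono (fun _ h => h) ?_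
    · simp only [Test.Holds, Expr.eval, h₁.2.2] at hb
      simp only [den, if_pos hb]
      refine (ihp hp.1.2 hk h₁.1 h0).mono (fun s₂ h₂ => ⟨h₂.1, fun i hi hi' => ?_⟩) le_rfl
      rw [h₂.2 i hi hi', h₁.2.1 i hi]
    · simp only [Test.Holds, Expr.eval, h₁.2.2] at hb
      simp only [den, if_neg hb]
      refine (ihq hp.2 hk h₁.1 h0).mono (fun s₂ h₂ => ⟨h₂.1, fun i hi hi' => ?_⟩) le_rfl
      rw [h₂.2 i hi hi', h₁.2.1 i hi]
    · simp only [cost, Test.cost, Expr.cost]; omega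
  | forn x p ih =>
    simp only [ok, Bool.and_eq_true, decide_eq_true_eq] at hp
    let I : ℕ → State → Prop := fun j s' =>
      s'.Agree (iter (fun j s => p.den n (s.setReg x j)) j σ) ∧ s'.reg k = j ∧
        ∀ i < k, userRegs ≤ i → s'.reg i = s.reg i
    have hreg : ∀ j, (iter (fun j s => p.den n (s.setReg x j)) j σ).reg 0 = n := by
      intro j
      induction j with
      | zero => exact h0
      | succ j ih' =>
        simp only [iter]
        rw [den_reg (keeps_zero hp.2)]
        rw [State.setReg_ne _ _ (by omega), ih']
    refine ((Runs.assign (R := I 0) ?_).seq fun s₁ h₁ =>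
      (Runs.countLoop (N := n) (T := 2 + p.cost n) I ?_ ?_ h₁).mono
        (fun s₂ h₂ => ⟨h₂.1, h₂.2.2⟩) le_rfl).mono (fun _ h => h) ?_
    · refine ⟨⟨?_, hs.2.1, hs.2.2⟩, by simp [Expr.eval], ?_⟩
      · intro i hi
        simp only [iter]
        rw [Function.update_of_ne (by omega), hs.1 i hi]
      · intro i hi _
        simp only
        rw [Function.update_of_ne (by omega)]
    · intro j s' h
      exact ⟨h.2.1, by rw [h.1.1 0 (by decide), hreg]⟩
    · intro j s' hj h
      refine (Runs.assign (R := fun s₂ => s₂ = s'.setReg x j) ?_).seq fun s₂ h₂ => ?_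
      · simp only [State.setReg, Expr.eval, h.2.1]
      · subst h₂
        refine (ih hp.2 (k := k + 1) (by omega)
          (σ := (iter (fun j s => p.den n (s.setReg x j)) j σ).setReg x j) ?_ ?_).mono
          (fun s₃ h₃ => ?_) le_rfl
        · refine ⟨fun i hi => ?_, h.1.2.1, h.1.2.2⟩
          by_cases hix : i = x
          · subst hix; simp [State.setReg_self]
          · rw [State.setReg_ne _ _ hix, State.setReg_ne _ _ hix, h.1.1 i hi]
        · rw [State.setReg_ne _ _ (by omega), hreg]
        · refine ⟨?_, ⟨fun i hi => ?_, h₃.1.2.1, h₃.1.2.2⟩, by simp, fun i hi hi' => ?_⟩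
          · rw [h₃.2 k (by omega) hk]
            simp only [State.setReg]
            rw [Function.update_of_ne (by omega), h.2.1]
          · simp only
            rw [Function.update_of_ne (by omega), h₃.1.1 i hi]
            rfl
          · simp only
            rw [Function.update_of_ne (by omega), h₃.2 i (by omega) hi']
            simp only [State.setReg]
            rw [Function.update_of_ne (by omega), h.2.2 i hi hi']
    · simp only [cost, Expr.cost]
      have : n * (2 + p.cost n + 9) = n * (p.cost n + 11) := by ring
      omega

end Stmt

end Slab

namespace Slab

/-! ### Logical connectives and search as terms -/

/-- The least element of `{0, …, n - 1}` satisfying `p`, or `n` if there is none. -/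
noncomputable def first {n : ℕ} (p : Fin n → Prop) : ℤ :=
  open Classical in ∑ x : Fin n, if ∃ y, y ≤ x ∧ p y then 0 else 1

/-- The sum counts the x that are strictly below all solutions. There are as many of these as the
value of the least solution, and n if there is no solution. -/
theorem first_spec {n : ℕ} (p : Fin n → Prop) :
    (∃ v : Fin n, first p = (v : ℕ) ∧ p v ∧ ∀ y, p y → v ≤ y) ∨
      (first p = n ∧ ∀ y, ¬ p y) := by
  classical
  by_cases h : ∃ y, p y
  · left
    obtain ⟨v, hv, hmin⟩ := WellFounded.has_min (wellFounded_lt (α := Fin n)) {y | p y} h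
    have hmin' : ∀ y, p y → v ≤ y := fun y hy => not_lt.1 (hmin y hy)
    refine ⟨v, ?_, hv, hmin'⟩
    have : first p = ∑ x : Fin n, if v ≤ x then (0 : ℤ) else 1 := by
      refine Finset.sum_congr rfl fun x _ => ?_
      have : (∃ y, y ≤ x ∧ p y) ↔ v ≤ x :=
        ⟨fun ⟨y, hy, hp⟩ => (hmin' y hp).trans hy, fun hx => ⟨v, hx, hv⟩⟩
      simp only [this]
    rw [this]
    have h2 : (∑ x : Fin n, if v ≤ x then (0 : ℤ) else 1)
        = ∑ x : Fin n, if x < v then (1 : ℤ) else 0 := by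
      refine Finset.sum_congr rfl fun x _ => ?_
      by_cases hx : v ≤ x
      · simp [hx]
      · simp [hx, not_le.1 hx]
    rw [h2, Finset.sum_boole]
    simp [Finset.filter_gt_eq_Iio]
  · right
    push Not at h
    exact ⟨by simp [first, h], h⟩

namespace Term

/-- A term used as a condition holds if its value is at least `1`. -/
def Tr (n : ℕ) (m : ℤ → ℤ) (t : Term) (ρ : ℕ → ℤ) : Prop :=
  1 ≤ t.eval n m ρ

/-- `a ≤ b` -/
def leT (a b : Term) : Term := .ite a b (.const 1) (.const 0)

/-- Negation. -/
def notT (a : Term) : Term := .ite (.const 1) a (.const 0) (.const 1)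

/-- Conjunction. -/
def andT (a b : Term) : Term := .ite (.const 1) a b (.const 0)

/-- Disjunction. -/
def orT (a b : Term) : Term := .ite (.const 1) a (.const 1) b

/-- Implication. -/
def impT (a b : Term) : Term := .ite (.const 1) a b (.const 1)

/-- Equality. -/
def eqT (a b : Term) : Term := andT (leT a b) (leT b a)

/-- The number of `x < n` satisfying a condition. -/
def countT (x : ℕ) (a : Term) : Term := .sum x (.ite (.const 1) a (.const 1) (.const 0))

/-- Existential quantifier over `x < n`. -/
def exT (x : ℕ) (a : Term) : Term := countT x a

/-- Universal quantifier over `x < n`. -/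
def allT (x : ℕ) (a : Term) : Term := notT (exT x (notT a))

/-- The least `y < n` satisfying a condition, or `n`; the variable `x` is auxiliary. -/
def firstT (x y : ℕ) (a : Term) : Term :=
  .sum x (.ite (.const 1) (exT y (andT (leT (.var y) (.var x)) a)) (.const 0) (.const 1))

variable {n : ℕ} {m : ℤ → ℤ} {ρ : ℕ → ℤ}

@[simp] theorem tr_leT {a b : Term} :
    (leT a b).Tr n m ρ ↔ a.eval n m ρ ≤ b.eval n m ρ := by
  simp only [Tr, leT, eval]; split_ifs <;> simp_all

@[simp] theorem tr_notT {a : Term} : (notT a).Tr n m ρ ↔ ¬ a.Tr n m ρ := by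
  by_cases h : 1 ≤ a.eval n m ρ <;> simp [Tr, notT, eval, h]

@[simp] theorem tr_andT {a b : Term} : (andT a b).Tr n m ρ ↔ a.Tr n m ρ ∧ b.Tr n m ρ := by
  by_cases h : 1 ≤ a.eval n m ρ <;> simp [Tr, andT, eval, h]

@[simp] theorem tr_orT {a b : Term} : (orT a b).Tr n m ρ ↔ a.Tr n m ρ ∨ b.Tr n m ρ := by
  by_cases h : 1 ≤ a.eval n m ρ <;> simp [Tr, orT, eval, h]

@[simp] theorem tr_impT {a b : Term} : (impT a b).Tr n m ρ ↔ (a.Tr n m ρ → b.Tr n m ρ) := by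
  by_cases h : 1 ≤ a.eval n m ρ <;> simp [Tr, impT, eval, h]

@[simp] theorem tr_eqT {a b : Term} :
    (eqT a b).Tr n m ρ ↔ a.eval n m ρ = b.eval n m ρ := by
  simp only [eqT, tr_andT, tr_leT]; omega

open Classical in
theorem eval_countT {x : ℕ} {a : Term} : (countT x a).eval n m ρ =
    (Finset.univ.filter fun j : Fin n => a.Tr n m (Function.update ρ x ((j : ℕ) : ℤ))).card := by
  rw [Finset.card_filter, Nat.cast_sum]
  refine Finset.sum_congr rfl fun j _ => ?_
  by_cases h : 1 ≤ a.eval n m (Function.update ρ x ((j : ℕ) : ℤ)) <;> simp [eval, Tr, h]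

@[simp] theorem tr_exT {x : ℕ} {a : Term} : (exT x a).Tr n m ρ ↔
    ∃ j : Fin n, a.Tr n m (Function.update ρ x ((j : ℕ) : ℤ)) := by
  classical
  rw [exT, Tr, eval_countT]
  rw [← Nat.cast_one, Nat.cast_le, Nat.one_le_iff_ne_zero, Finset.card_ne_zero,
    Finset.filter_nonempty_iff]
  simp

@[simp] theorem tr_allT {x : ℕ} {a : Term} : (allT x a).Tr n m ρ ↔
    ∀ j : Fin n, a.Tr n m (Function.update ρ x ((j : ℕ) : ℤ)) := by
  simp [allT]

theorem eval_firstT {x y : ℕ} {a : Term} (hxy : x ≠ y) {p : Fin n → Prop}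
    (h : ∀ i j : Fin n, a.Tr n m (Function.update (Function.update ρ x ((i : ℕ) : ℤ)) y
      ((j : ℕ) : ℤ)) ↔ p j) : (firstT x y a).eval n m ρ = first p := by
  classical
  simp only [firstT, eval, first]
  refine Finset.sum_congr rfl fun i _ => ?_
  have : 1 ≤ (exT y (andT (leT (.var y) (.var x)) a)).eval n m
      (Function.update ρ x ((i : ℕ) : ℤ)) ↔ ∃ y, y ≤ i ∧ p y := by
    rw [← Tr, tr_exT]
    refine exists_congr fun j => ?_
    rw [tr_andT, h, tr_leT]
    simp [eval, hxy]
  simp only [this]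

end Term

/-! ### Polynomial bounds -/

/-- `f n ≤ C * n ^ c` for `n ≥ 1`. -/
def PolyBounded (f : ℕ → ℕ) : Prop :=
  ∃ C c : ℕ, ∀ n, 1 ≤ n → f n ≤ C * n ^ c

namespace PolyBounded

theorem const (a : ℕ) : PolyBounded fun _ => a := ⟨a, 0, by simp⟩

theorem id : PolyBounded fun n => n := ⟨1, 1, by simp⟩

theorem add {f g : ℕ → ℕ} (hf : PolyBounded f) (hg : PolyBounded g) :
    PolyBounded fun n => f n + g n := by
  obtain ⟨C, c, h⟩ := hf
  obtain ⟨D, d, h'⟩ := hg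
  refine ⟨C + D, c + d, fun n hn => ?_⟩
  have h1 : n ^ c ≤ n ^ (c + d) := Nat.pow_le_pow_right hn (by omega)
  have h2 : n ^ d ≤ n ^ (c + d) := Nat.pow_le_pow_right hn (by omega)
  calc f n + g n ≤ C * n ^ c + D * n ^ d := Nat.add_le_add (h n hn) (h' n hn)
    _ ≤ C * n ^ (c + d) + D * n ^ (c + d) := by gcongr
    _ = _ := by ring

theorem mul {f g : ℕ → ℕ} (hf : PolyBounded f) (hg : PolyBounded g) :
    PolyBounded fun n => f n * g n := by
  obtain ⟨C, c, h⟩ := hf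
  obtain ⟨D, d, h'⟩ := hg
  refine ⟨C * D, c + d, fun n hn => ?_⟩
  calc f n * g n ≤ (C * n ^ c) * (D * n ^ d) := Nat.mul_le_mul (h n hn) (h' n hn)
    _ = _ := by ring

end PolyBounded

theorem Term.polyBounded_cost (t : Term) : PolyBounded fun n => t.cost n := by
  induction t with
  | const | var => exact .const _
  | load a iha => exact iha.add (.const _)
  | add a b iha ihb | sub a b iha ihb => exact (iha.add ihb).add (.const _)
  | ite a b c d iha ihb ihc ihd => exact (((iha.add ihb).add ihc).add ihd).add (.const _)
  | sum x t ih => exact (PolyBounded.id.mul (ih.add (.const _))).add (.const _)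

theorem Stmt.polyBounded_cost (p : Stmt) : PolyBounded fun n => p.cost n := by
  induction p with
  | skip => exact .const _
  | assign x t | write t => exact t.polyBounded_cost.add (.const _)
  | store a t => exact (a.polyBounded_cost.add t.polyBounded_cost).add (.const _)
  | seq p q ihp ihq => exact ihp.add ihq
  | cond t p q ihp ihq => exact ((t.polyBounded_cost.add ihp).add ihq).add (.const _)
  | forn x p ih => exact (PolyBounded.id.mul (ih.add (.const _))).add (.const _)

/-! ### A long loop -/

/-- Execute `init`, and then `body` with register `6` running below the value of register `5`. -/
def longLoop (init body : Stmt) : Prog :=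
  .seq (init.comp userRegs) (.seq (.assign 6 (.const 0)) (countLoop 6 5 (body.comp userRegs)))

theorem runs_longLoop {n N : ℕ} {init body : Stmt} (hi : init.ok) (hb : body.ok)
    (h5 : body.keeps 5) (h6 : body.keeps 6) {s : State} (h0 : s.reg 0 = n)
    (hN : (init.den n s).reg 5 = N) :
    Runs (longLoop init body) s
      (fun s' => s'.out = (iter (fun w s => body.den n (s.setReg 6 w)) N (init.den n s)).out)
      (init.cost n + (2 + (N * (body.cost n + 9) + 5))) := by
  set f : ℕ → State → State := fun w s => body.den n (s.setReg 6 w) with hf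
  have hk : ∀ k, k ≠ 6 → body.keeps k → ∀ j,
      (iter f j (init.den n s)).reg k = (init.den n s).reg k := by
    intro k hk hbk j
    induction j with
    | zero => rfl
    | succ j ih =>
      simp only [iter, hf]
      rw [Stmt.den_reg hbk, State.setReg_ne _ _ hk]
      exact ih
  have h0' : (init.den n s).reg 0 = n := by rw [Stmt.den_reg (Stmt.keeps_zero hi), h0]
  -- Register 6 is masked on both sides: the machine has already incremented it, while the iterated
  -- state still holds the value of the previous round.
  let I : ℕ → State → Prop := fun j s' =>
    (s'.setReg 6 0).Agree ((iter f j (init.den n s)).setReg 6 0) ∧ s'.reg 6 = j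
  refine (Stmt.runs init hi le_rfl (s := s) (σ := s) ⟨fun _ _ => rfl, rfl, rfl⟩ h0).seq
    fun s₁ h₁ => (Runs.assign (R := I 0) ?_).seq fun s₂ h₂ =>
      (Runs.countLoop (N := N) (T := body.cost n) I ?_ ?_ h₂).mono (fun s' h => h.1.2.2) le_rfl
  · refine ⟨⟨fun i hi => ?_, h₁.1.2.1, h₁.1.2.2⟩, by simp [Expr.eval]⟩
    by_cases hi6 : i = 6
    · subst hi6; simp [State.setReg_self]
    · rw [State.setReg_ne _ _ hi6, State.setReg_ne _ _ hi6]
      simp only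
      rw [Function.update_of_ne hi6]
      exact h₁.1.1 i hi
  · intro j s' h
    refine ⟨h.2, ?_⟩
    have := h.1.1 5 (by decide)
    rw [State.setReg_ne _ _ (by decide), State.setReg_ne _ _ (by decide), hk 5 (by decide) h5,
      hN] at this
    exact this
  · intro j s' hj h
    refine (Stmt.runs body hb le_rfl (s := s') (σ := (iter f j (init.den n s)).setReg 6 j)
      ?_ ?_).mono (fun s₃ h₃ => ⟨?_, ⟨fun i hi => ?_, h₃.1.2.1, h₃.1.2.2⟩, by simp⟩) le_rfl
    · refine ⟨fun i hi => ?_, h.1.2.1, h.1.2.2⟩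
      by_cases hi6 : i = 6
      · subst hi6; rw [State.setReg_self, h.2]
      · have := h.1.1 i hi
        rw [State.setReg_ne _ _ hi6, State.setReg_ne _ _ hi6] at this
        rw [State.setReg_ne _ _ hi6, this]
    · rw [State.setReg_ne _ _ (by decide), hk 0 (by decide) (Stmt.keeps_zero hb), h0']
    · rw [h₃.1.1 6 (by decide), Stmt.den_reg h6, State.setReg_self]
    · by_cases hi6 : i = 6
      · subst hi6; rw [State.setReg_self, State.setReg_self]
      · rw [State.setReg_ne _ _ hi6, State.setReg_ne _ _ hi6]
        simp only
        rw [Function.update_of_ne hi6]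
        exact h₃.1.1 i hi

end Slab

namespace Slab

/-! ### Connected sets -/

/-- Apply the hypothesis to the set of vertices reachable from a inside S. Together with its
converse `ConnectedSet.mem_of_closed`, this replaces walks by sets closed under edges inside S. -/
theorem connectedSet_of_closed {V : Type*} {G : SimpleGraph V} {S : Finset V} {a : V}
    (ha : a ∈ S) (h : ∀ T : Set V, a ∈ T →
      (∀ u v, u ∈ T → u ∈ S → v ∈ S → G.Adj u v → v ∈ T) → ∀ v ∈ S, v ∈ T) :
    ConnectedSet G S := by
  rw [ConnectedSet, SimpleGraph.connected_iff_exists_forall_reachable]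
  refine ⟨⟨a, ha⟩, fun ⟨v, hv⟩ => ?_⟩
  obtain ⟨_, hr⟩ := h {v | ∃ hv : v ∈ (S : Set V),
    (G.induce (S : Set V)).Reachable ⟨a, ha⟩ ⟨v, hv⟩} ⟨ha, .rfl⟩ (by
      rintro u v ⟨hu, hr⟩ _ hv huv
      exact ⟨hv, hr.trans (SimpleGraph.Adj.reachable (by simpa using huv))⟩) v hv
  exact hr

theorem ConnectedSet.mem_of_closed {V : Type*} {G : SimpleGraph V} {S : Finset V}
    (hS : ConnectedSet G S) {T : Set V} {a : V} (ha : a ∈ S) (haT : a ∈ T)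
    (hT : ∀ u v, u ∈ T → u ∈ S → v ∈ S → G.Adj u v → v ∈ T) {v : V} (hv : v ∈ S) : v ∈ T := by
  have hr := hS.preconnected ⟨a, ha⟩ ⟨v, hv⟩
  rw [SimpleGraph.reachable_iff_reflTransGen] at hr
  have : ∀ w : (S : Set V), Relation.ReflTransGen (G.induce (S : Set V)).Adj ⟨a, ha⟩ w →
      (w : V) ∈ T := by
    intro w hw
    induction hw with
    | refl => exact haT
    | tail _ h ih => exact hT _ _ ih (Subtype.property _) (Subtype.property _) (by simpa using h)
  exact this _ hr

/-! ### The branching process -/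

/-- A configuration of the branching process: a vertex `v` is undecided if `σ v = 0`, excluded if
`σ v < 0`, and belongs to part number `σ v` otherwise. The remaining branching decisions are the
base-4 digits of `rem / P`. -/
@[ext] structure Config (n : ℕ) where
  rem : ℤ
  ok : ℤ
  σ : Fin n → ℤ

/-- The leading base-4 digit of `x / P`. -/
def digit (P x : ℤ) : ℤ :=
  if 3 * P ≤ 4 * x then 3 else if 2 * P ≤ 4 * x then 2 else if P ≤ 4 * x then 1 else 0

theorem digit_mem (P x : ℤ) : 0 ≤ digit P x ∧ digit P x ≤ 3 := by
  unfold digit; split_ifs <;> simp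

theorem digit_rem {P x : ℤ} (h0 : 0 ≤ x) (hx : x < P) :
    0 ≤ 4 * x - digit P x * P ∧ 4 * x - digit P x * P < P := by
  unfold digit; split_ifs <;> omega

/-- The digit is the quotient of 4x by P, found by comparisons alone, so this is uniqueness of
division with remainder. -/
theorem digit_eq {P x d y : ℤ} (h : 4 * x = d * P + y) (h0 : 0 ≤ y) (hy : y < P) (hd : 0 ≤ d)
    (hd3 : d ≤ 3) : digit P x = d := by
  unfold digit
  interval_cases d <;> split_ifs <;> omega

section Search

variable {n : ℕ} (G : SimpleGraph (Fin n))

/-- The first undecided vertex with a neighbour in one of the parts. -/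
noncomputable def pick (σ : Fin n → ℤ) : ℤ :=
  first fun v => σ v = 0 ∧ ∃ u, G.Adj u v ∧ 1 ≤ σ u

/-- The least number of a part adjacent to `v`. -/
noncomputable def nbrPart (σ : Fin n → ℤ) (v : ℤ) : ℤ :=
  first (fun i : Fin n => ∃ u w : Fin n, ((w : ℕ) : ℤ) = v ∧ G.Adj u w ∧ σ u = (i : ℕ) + 1) + 1

/-- The new value of the picked vertex. -/
noncomputable def newValue (P : ℤ) (X : Config n) : ℤ :=
  if 1 ≤ digit P X.rem then nbrPart G X.σ (pick G X.σ) + digit P X.rem - 2 else -1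

open Classical in
/-- One branching decision. -/
noncomputable def step (r : ℕ) (P : ℤ) (X : Config n) : Config n where
  rem := 4 * X.rem - digit P X.rem * P
  ok := if digit P X.rem ≤ 0 ∨ (pick G X.σ + 1 ≤ n ∧ 1 ≤ newValue G P X ∧ newValue G P X ≤ r)
    then X.ok else 0
  σ := fun y => if ((y : ℕ) : ℤ) = pick G X.σ then newValue G P X else X.σ y

variable {G} {r : ℕ} {P : ℤ}

theorem pick_spec (σ : Fin n → ℤ) :
    (∃ v : Fin n, pick G σ = (v : ℕ) ∧ σ v = 0 ∧ ∃ u, G.Adj u v ∧ 1 ≤ σ u) ∨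
      (pick G σ = n ∧ ∀ v, σ v = 0 → ∀ u, G.Adj u v → ¬ 1 ≤ σ u) := by
  rcases first_spec fun v => σ v = 0 ∧ ∃ u, G.Adj u v ∧ 1 ≤ σ u with ⟨v, h1, h2, _⟩ | ⟨h1, h2⟩
  · exact .inl ⟨v, h1, h2⟩
  · exact .inr ⟨h1, fun v hv u hu h => h2 v ⟨hv, u, hu, h⟩⟩

theorem step_ok {X : Config n} (h : (step G r P X).ok = 1) : X.ok = 1 ∧
    (digit P X.rem ≤ 0 ∨ (pick G X.σ + 1 ≤ n ∧ 1 ≤ newValue G P X ∧ newValue G P X ≤ r)) := by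
  simp only [step] at h
  split_ifs at h with hc
  · exact ⟨h, hc⟩
  · simp at h

theorem iterate_step_ok {j : ℕ} {X : Config n} (h : ((step G r P)^[j] X).ok = 1) : X.ok = 1 := by
  induction j generalizing X with
  | zero => exact h
  | succ j ih => exact (step_ok (ih h)).1

/-- Decisions are final: a picked vertex has value 0, and a search without success returns n, which
is not a vertex. -/
theorem step_σ_of_ne {X : Config n} {v : Fin n} (h : X.σ v ≠ 0) :
    (step G r P X).σ v = X.σ v := by
  simp only [step]
  refine if_neg fun hv => ?_
  rcases pick_spec (G := G) X.σ with ⟨w, hw, h0, _⟩ | ⟨hn, _⟩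
  · have : v = w := Fin.ext (by exact_mod_cast hv.trans hw)
    exact h (this ▸ h0)
  · have := v.2
    omega

theorem iterate_step_σ_of_ne {j : ℕ} {X : Config n} {v : Fin n} (h : X.σ v ≠ 0) :
    ((step G r P)^[j] X).σ v = X.σ v := by
  induction j generalizing X with
  | zero => rfl
  | succ j ih =>
    rw [Function.iterate_succ_apply, ih (by rwa [step_σ_of_ne h]), step_σ_of_ne h]

theorem iterate_step_σ_le {j : ℕ} {X : Config n} (hX : ∀ v, X.σ v ≤ r)
    (h : ((step G r P)^[j] X).ok = 1) (v : Fin n) : ((step G r P)^[j] X).σ v ≤ r := by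
  induction j generalizing X with
  | zero => exact hX v
  | succ j ih =>
    refine ih (X := step G r P X) (fun v => ?_) h
    have := (step_ok (iterate_step_ok (j := j) h)).2
    simp only [step]
    split_ifs
    · rcases this with h0 | h0
      · rw [newValue, if_neg (by omega)]
        omega
      · exact h0.2.2
    · exact hX v

/-- Different sequences of decisions lead to different results. -/
theorem rem_close_of_result_eq {j : ℕ} {X X' : Config n} (hσ : X.σ = X'.σ)
    (h0 : 0 ≤ X.rem) (hP : X.rem < P) (h0' : 0 ≤ X'.rem) (hP' : X'.rem < P)
    (hok : ((step G r P)^[j] X).ok = 1) (hok' : ((step G r P)^[j] X').ok = 1)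
    (hres : ∀ v, max (((step G r P)^[j] X).σ v) 0 = max (((step G r P)^[j] X').σ v) 0) :
    4 ^ j * |X.rem - X'.rem| < P := by
  induction j generalizing X X' with
  | zero =>
    rw [pow_zero, one_mul, abs_lt]
    constructor <;> omega
  | succ j ih =>
    -- The leading digits agree. If w is picked, its new value is non-zero in both runs, hence final
    -- and visible in the results: digit 0 shows up as 0, and the digits 1, 2, 3 give three
    -- different positive values. If nothing can be picked, `ok` forces both digits to be 0.
    have hd : digit P X.rem = digit P X'.rem := by
      have c := (step_ok (iterate_step_ok (j := j) hok)).2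
      have c' := (step_ok (iterate_step_ok (j := j) hok')).2
      have m := digit_mem P X.rem
      have m' := digit_mem P X'.rem
      rcases pick_spec (G := G) X.σ with ⟨w, hw, -, -⟩ | ⟨hn, -⟩
      · have e : (step G r P X).σ w = newValue G P X := by simp [step, hw]
        have e' : (step G r P X').σ w = newValue G P X' := by simp [step, ← hσ, hw]
        have hv := hres w
        simp only [Function.iterate_succ_apply] at hv
        have ne : newValue G P X ≠ 0 := by
          rcases c with c | c
          · rw [newValue, if_neg (by omega)]; omega
          · omega
        have ne' : newValue G P X' ≠ 0 := by
          rcases c' with c | c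
          · rw [newValue, if_neg (by omega)]; omega
          · omega
        rw [iterate_step_σ_of_ne (by rwa [e]), iterate_step_σ_of_ne (by rwa [e']), e, e'] at hv
        simp only [newValue, ← hσ] at hv c c' ne ne'
        split_ifs at hv c c' ne ne' <;> omega
      · rw [← hσ] at c'
        omega
    have key := ih (X := step G r P X) (X' := step G r P X')
      (by simp only [step, newValue, hσ, hd]) (digit_rem h0 hP).1 (digit_rem h0 hP).2
      (digit_rem h0' hP').1 (digit_rem h0' hP').2 hok hok' hres
    -- Equal digits cancel, so a step multiplies the difference by exactly 4; this supplies the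
    -- additional factor in the bound.
    have : (step G r P X).rem - (step G r P X').rem = 4 * (X.rem - X'.rem) := by
      simp only [step, hd]; ring
    rw [this, abs_mul, abs_of_pos (by norm_num : (0 : ℤ) < 4)] at key
    calc (4 : ℤ) ^ (j + 1) * |X.rem - X'.rem| = 4 ^ j * (4 * |X.rem - X'.rem|) := by ring
      _ < P := key

/-- The properties of the vertex labels of a slab that guide the branching process. -/
structure IsTarget (G : SimpleGraph (Fin n)) (r : ℕ) (ℓ : Fin n → ℤ) : Prop where
  le : r ≤ n
  nonneg : ∀ v, 0 ≤ ℓ v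
  le_r : ∀ v, ℓ v ≤ r
  adj : ∀ u v, G.Adj u v → 1 ≤ ℓ u → 1 ≤ ℓ v → |ℓ u - ℓ v| ≤ 1
  closed : ∀ (T : Set (Fin n)) (a : Fin n), 1 ≤ ℓ a → a ∈ T →
    (∀ u v, u ∈ T → 1 ≤ ℓ u → 1 ≤ ℓ v → G.Adj u v → v ∈ T) → ∀ v, 1 ≤ ℓ v → v ∈ T

/-- The decisions made so far agree with the target. -/
structure Agrees (σ ℓ : Fin n → ℤ) : Prop where
  pos : ∀ v, 1 ≤ σ v → ℓ v = σ v
  neg : ∀ v, σ v < 0 → ℓ v = 0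
  root : ∃ a, 1 ≤ σ a

open Classical in
/-- The vertices of the target and of its neighbourhood that are still undecided. -/
noncomputable def undecided (G : SimpleGraph (Fin n)) (σ ℓ : Fin n → ℤ) : Finset (Fin n) :=
  Finset.univ.filter fun v => σ v = 0 ∧ (1 ≤ ℓ v ∨ ∃ u, G.Adj u v ∧ 1 ≤ ℓ u)

theorem Agrees.result {σ ℓ : Fin n → ℤ} (hℓ : IsTarget G r ℓ) (h : Agrees σ ℓ)
    (hall : ∀ v, 1 ≤ ℓ v → σ v ≠ 0) (v : Fin n) : max (σ v) 0 = ℓ v := by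
  have h1 := h.pos v
  have h2 := h.neg v
  have h3 := hall v
  have h4 := hℓ.nonneg v
  omega

/-- The set of placed vertices is closed under edges inside the target: a neighbour of a placed
vertex is not undecided, since the process is stuck, and not excluded if it belongs to the target.
As the target is connected, all of it has been placed. -/
theorem Agrees.result_of_stuck {σ ℓ : Fin n → ℤ} (hℓ : IsTarget G r ℓ) (h : Agrees σ ℓ)
    (hs : ∀ v, σ v = 0 → ∀ u, G.Adj u v → ¬ 1 ≤ σ u) (v : Fin n) : max (σ v) 0 = ℓ v := by
  refine h.result hℓ (fun v hv => ?_) v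
  obtain ⟨a, ha⟩ := h.root
  have : 1 ≤ σ v := by
    refine hℓ.closed {v | 1 ≤ σ v} a (by rw [h.pos a ha]; exact ha) ha
      (fun u v (hu : 1 ≤ σ u) _ hv huv => (?_ : 1 ≤ σ v)) v hv
    have h1 := h.neg v
    have h2 := fun h0 => hs v h0 u huv hu
    change 1 ≤ σ v
    rcases lt_trichotomy (σ v) 0 with h0 | h0 | h0
    · have := h1 h0
      omega
    · exact (h2 h0).elim
    · omega
  omega

/-- Each decision copies the target. The picked vertex belongs to the target or its neighbourhood,
so it leaves `undecided`, whose size therefore bounds the number of decisions. The scale S makes the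
induction work: P stays fixed while one digit fewer remains, so S turns into 4S after a step. -/
theorem exists_decisions {ℓ : Fin n → ℤ} (hℓ : IsTarget G r ℓ) (j : ℕ) :
    ∀ (σ : Fin n → ℤ), Agrees σ ℓ → (undecided G σ ℓ).card ≤ j → ∀ S : ℤ, 0 < S →
      ∃ y : ℤ, 0 ≤ y ∧ y < 4 ^ j ∧ ((step G r (S * 4 ^ j))^[j] ⟨S * y, 1, σ⟩).ok = 1 ∧
        ∀ v, max (((step G r (S * 4 ^ j))^[j] ⟨S * y, 1, σ⟩).σ v) 0 = ℓ v := by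
  induction j with
  | zero =>
    intro σ h hc S hS
    refine ⟨0, le_rfl, by simp, rfl, fun v => h.result hℓ (fun v hv hv0 => ?_) v⟩
    have : v ∈ undecided G σ ℓ := by simp [undecided, hv0, hv]
    rw [Nat.le_zero, Finset.card_eq_zero] at hc
    simp [hc] at this
  | succ j ih =>
    intro σ h hc S hS
    rcases pick_spec (G := G) σ with ⟨w, hw, hw0, u, huw, hu⟩ | ⟨hn, hstuck⟩
    · obtain ⟨i, ⟨u', huw', hu'⟩, hi⟩ : ∃ i : ℤ, (∃ u', G.Adj u' w ∧ σ u' = i) ∧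
          nbrPart G σ w = i := by
        rcases first_spec fun i : Fin n => ∃ u w' : Fin n, ((w' : ℕ) : ℤ) = (w : ℕ) ∧
            G.Adj u w' ∧ σ u = (i : ℕ) + 1 with ⟨i, hi, ⟨u', w', hw', ha, hu'⟩, -⟩ | ⟨-, hno⟩
        · have : w' = w := Fin.ext (by exact_mod_cast hw')
          subst this
          exact ⟨(i : ℕ) + 1, ⟨u', ha, hu'⟩, by rw [nbrPart, hi]⟩
        -- The search for a part number runs over 1, …, n only; this misses nothing because r ≤ n.
        · exfalso
          have h1 := hℓ.le_r u
          have h2 := hℓ.le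
          rw [h.pos u hu] at h1
          refine hno ⟨(σ u - 1).toNat, by omega⟩ ⟨u, w, rfl, huw, ?_⟩
          simp only
          omega
      have hi1 : 1 ≤ i := by
        by_contra hlt
        rcases first_spec fun i : Fin n => ∃ u w' : Fin n, ((w' : ℕ) : ℤ) = (w : ℕ) ∧
            G.Adj u w' ∧ σ u = (i : ℕ) + 1 with ⟨k, hk, -⟩ | ⟨hk, -⟩ <;>
          rw [nbrPart, hk] at hi <;> omega
      have hℓu' : ℓ u' = i := by rw [h.pos u' (by omega), hu']
      have hadj := hℓ.adj u' w huw' (by omega)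
      rw [hℓu'] at hadj
      have hnn := hℓ.nonneg w
      have hle := hℓ.le_r w
      -- Digit 0 excludes w, and the digits 1, 2, 3 put it into part i − 1, i, i + 1. As w is
      -- adjacent to part i, the target leaves no other possibility.
      set d : ℤ := if ℓ w = 0 then 0 else ℓ w - i + 2 with hd
      set z : ℤ := if ℓ w = 0 then -1 else ℓ w with hz
      have hd03 : 0 ≤ d ∧ d ≤ 3 := by
        rw [hd]
        split_ifs with h0
        · omega
        · have := abs_le.1 (hadj (by omega))
          omega
      have hz' : z = if 1 ≤ d then i + d - 2 else -1 := by
        rw [hz, hd]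
        by_cases h0 : ℓ w = 0
        · simp [h0]
        · have := abs_le.1 (hadj (by omega))
          rw [if_neg h0, if_neg h0, if_pos (by omega)]
          ring
      have hz0 : z ≠ 0 := by
        rw [hz]; split_ifs <;> omega
      have hagr : Agrees (fun v => if v = w then z else σ v) ℓ := by
        refine ⟨fun v hv => ?_, fun v hv => ?_, ?_⟩
        · by_cases hvw : v = w
          · subst hvw
            simp only [if_true] at hv ⊢
            rw [hz] at hv ⊢
            split_ifs at hv ⊢ <;> omega
          · simp only [if_neg hvw] at hv ⊢
            exact h.pos v hv
        · by_cases hvw : v = w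
          · subst hvw
            simp only [if_true] at hv
            rw [hz] at hv
            split_ifs at hv with h0
            · exact h0
            · omega
          · simp only [if_neg hvw] at hv
            exact h.neg v hv
        · obtain ⟨a, ha⟩ := h.root
          refine ⟨a, ?_⟩
          rw [if_neg (by rintro rfl; omega)]
          exact ha
      have hcard : (undecided G (fun v => if v = w then z else σ v) ℓ).card ≤ j := by
        have hw' : w ∈ undecided G σ ℓ := by
          simp only [undecided, Finset.mem_filter, Finset.mem_univ, true_and]
          exact ⟨hw0, .inr ⟨u, huw, by rw [h.pos u hu]; exact hu⟩⟩
        have hsub : undecided G (fun v => if v = w then z else σ v) ℓ ⊆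
            (undecided G σ ℓ).erase w := by
          intro v hv
          simp only [undecided, Finset.mem_filter, Finset.mem_univ, true_and,
            Finset.mem_erase] at hv ⊢
          by_cases hvw : v = w
          · rw [if_pos hvw] at hv
            exact absurd hv.1 hz0
          · rw [if_neg hvw] at hv
            exact ⟨hvw, hv⟩
        have := Finset.card_le_card hsub
        rw [Finset.card_erase_of_mem hw'] at this
        omega
      obtain ⟨y, hy0, hy, hok, hres⟩ := ih _ hagr hcard (4 * S) (by omega)
      have hpow : (0 : ℤ) < 4 ^ j := by positivity
      refine ⟨d * 4 ^ j + y, add_nonneg (mul_nonneg hd03.1 hpow.le) hy0, ?_, ?_⟩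
      · rw [pow_succ]
        nlinarith
      have hP : S * 4 ^ (j + 1) = 4 * S * 4 ^ j := by ring
      have hdig : digit (S * 4 ^ (j + 1)) (S * (d * 4 ^ j + y)) = d := by
        refine digit_eq (y := 4 * S * y) (by ring) (by positivity) ?_ hd03.1 hd03.2
        rw [hP]
        exact mul_lt_mul_of_pos_left hy (by omega)
      have hnew : newValue G (S * 4 ^ (j + 1)) ⟨S * (d * 4 ^ j + y), 1, σ⟩ = z := by
        rw [hz']
        simp only [newValue, hdig, hw, hi]
      have hstep : step G r (S * 4 ^ (j + 1)) ⟨S * (d * 4 ^ j + y), 1, σ⟩ =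
          ⟨4 * S * y, 1, fun v => if v = w then z else σ v⟩ := by
        ext v
        · simp only [step, hdig]
          ring
        · simp only [step, hdig, hnew]
          refine if_pos ?_
          by_cases h0 : ℓ w = 0
          · left
            rw [hd, if_pos h0]
          · right
            have := w.2
            rw [hw, hz, if_neg h0]
            exact ⟨by omega, by omega, hle⟩
        · simp only [step, hnew, hw, Nat.cast_inj, Fin.val_inj]
      rw [Function.iterate_succ_apply, hstep, hP]
      exact ⟨hok, hres⟩
    -- If nothing can be picked, the remaining digits are chosen to be 0; then the configuration is
    -- a fixed point of `step`.
    · have hdig : digit (S * 4 ^ (j + 1)) (S * 0) = 0 :=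
        digit_eq (y := 0) (by ring) le_rfl (by positivity) le_rfl (by norm_num)
      have hstep : step G r (S * 4 ^ (j + 1)) ⟨S * 0, 1, σ⟩ = ⟨S * 0, 1, σ⟩ := by
        ext v
        · simp only [step, hdig]; ring
        · simp only [step, hdig]; simp
        · simp only [step, hn]
          refine if_neg ?_
          have := v.2
          omega
      refine ⟨0, le_rfl, by positivity, ?_⟩
      rw [Function.iterate_fixed hstep]
      exact ⟨rfl, h.result_of_stuck hℓ hstuck⟩

/-! ### Connectivity by marking -/

variable (G)

open Classical in
/-- Mark the first vertex of each class. -/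
noncomputable def markInit (σ : Fin n → ℤ) : Fin n → ℤ :=
  fun x => if ∀ u, σ u = σ x → x ≤ u then 1 else 0

/-- The first unmarked vertex with a marked neighbour in its class. -/
noncomputable def markPick (σ M : Fin n → ℤ) : ℤ :=
  first fun x => M x ≠ 1 ∧ ∃ u, M u = 1 ∧ G.Adj u x ∧ σ u = σ x

/-- Mark one more vertex. -/
noncomputable def markStep (σ M : Fin n → ℤ) : Fin n → ℤ :=
  fun x => if ((x : ℕ) : ℤ) = markPick G σ M then 1 else M x

/-- The vertices that are connected to the first vertex of their class. -/
noncomputable def marks (σ : Fin n → ℤ) : Fin n → ℤ :=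
  (markStep G σ)^[n] (markInit σ)

variable {G}

theorem markStep_cases (σ M : Fin n → ℤ) :
    (∃ w, M w ≠ 1 ∧ (∃ u, M u = 1 ∧ G.Adj u w ∧ σ u = σ w) ∧
      markStep G σ M = fun x => if x = w then 1 else M x) ∨
    (markStep G σ M = M ∧ ∀ u x, M u = 1 → G.Adj u x → σ u = σ x → M x = 1) := by
  rcases first_spec fun x => M x ≠ 1 ∧ ∃ u, M u = 1 ∧ G.Adj u x ∧ σ u = σ x with
    ⟨w, hw, ⟨h1, h2⟩, -⟩ | ⟨hn, hno⟩
  · refine .inl ⟨w, h1, h2, ?_⟩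
    funext x
    simp only [markStep, markPick, hw, Nat.cast_inj, Fin.val_inj]
  · refine .inr ⟨?_, fun u x hu hux he => ?_⟩
    · funext x
      simp only [markStep, markPick, hn]
      refine if_neg ?_
      have := x.2
      omega
    · by_contra hx
      exact hno x ⟨hx, u, hu, hux, he⟩

theorem iterate_markStep_mono {σ M : Fin n → ℤ} {v : Fin n} (h : M v = 1) (k : ℕ) :
    (markStep G σ)^[k] M v = 1 := by
  induction k generalizing M with
  | zero => exact h
  | succ k ih =>
    rw [Function.iterate_succ_apply]
    refine ih ?_
    simp only [markStep]
    split_ifs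
    · rfl
    · exact h

/-- A round either finds the marking closed or marks a new vertex. So after k rounds the marking is
closed or has at least k vertices, and for k = n the second case means that everything is marked. -/
theorem marks_closed {σ : Fin n → ℤ} {u x : Fin n} (hu : marks G σ u = 1) (hux : G.Adj u x)
    (he : σ u = σ x) : marks G σ x = 1 := by
  classical
  have key : ∀ k, (∀ u x, (markStep G σ)^[k] (markInit σ) u = 1 → G.Adj u x → σ u = σ x →
      (markStep G σ)^[k] (markInit σ) x = 1) ∨
      k ≤ (Finset.univ.filter fun v => (markStep G σ)^[k] (markInit σ) v = 1).card := by
    intro k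
    induction k with
    | zero => exact .inr (Nat.zero_le _)
    | succ k ih =>
      simp only [Function.iterate_succ_apply']
      generalize (markStep G σ)^[k] (markInit σ) = M at ih
      rcases markStep_cases (G := G) σ M with ⟨w, hw, ⟨u, hu, huw, he⟩, hM⟩ | ⟨hM, hc⟩
      · right
        have ih' := ih.resolve_left fun h => hw (h u w hu huw he)
        have : (Finset.univ.filter fun v => M v = 1) ⊂
            Finset.univ.filter fun v => markStep G σ M v = 1 := by
          refine Finset.ssubset_iff.2 ⟨w, by simpa using hw, fun v hv => ?_⟩
          simp only [Finset.mem_insert, Finset.mem_filter, Finset.mem_univ, true_and] at hv ⊢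
          rw [hM]
          by_cases hvw : v = w
          · simp [hvw]
          · simpa [hvw] using hv
        have := Finset.card_lt_card this
        omega
      · left
        rw [hM]
        exact hc
  rcases key n with h | h
  · exact h u x hu hux he
  · have : (Finset.univ.filter fun v => (markStep G σ)^[n] (markInit σ) v = 1) =
        Finset.univ := by
      refine Finset.eq_univ_of_card _ (le_antisymm (Finset.card_le_univ _) ?_)
      simpa using h
    have hx := Finset.mem_univ x
    rw [← this] at hx
    exact (Finset.mem_filter.1 hx).2

/-- Initially only the first vertex of a class is marked, and marks spread only along edges inside a
class. -/
theorem marks_sound {σ : Fin n → ℤ} {a v : Fin n} (ha : ∀ u, σ u = σ a → a ≤ u)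
    {T : Set (Fin n)} (haT : a ∈ T)
    (hT : ∀ u x, u ∈ T → σ u = σ a → σ x = σ a → G.Adj u x → x ∈ T)
    (hv : marks G σ v = 1) (he : σ v = σ a) : v ∈ T := by
  have key : ∀ k v, (markStep G σ)^[k] (markInit σ) v = 1 → σ v = σ a → v ∈ T := by
    intro k
    induction k with
    | zero =>
      intro v hv he
      simp only [Function.iterate_zero, id, markInit] at hv
      split_ifs at hv with h
      · have : v = a := le_antisymm (h a he.symm) (ha v he)
        exact this ▸ haT
      · simp at hv
    | succ k ih =>
      intro v hv he
      rw [Function.iterate_succ_apply'] at hv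
      rcases markStep_cases (G := G) σ ((markStep G σ)^[k] (markInit σ)) with
        ⟨w, -, ⟨u, hu, huw, huσ⟩, hM⟩ | ⟨hM, -⟩
      · rw [hM] at hv
        by_cases hvw : v = w
        · subst hvw
          exact hT u v (ih u hu (huσ.trans he)) (huσ.trans he) he huw
        · simp only [if_neg hvw] at hv
          exact ih v hv he
      · rw [hM] at hv
        exact ih v hv he
  exact key n v hv he

/-- A class is connected exactly if it is reached from its first vertex along edges inside the
class, and this is what the marking computes. Classes with non-positive labels are marked too, but
play no role. -/
theorem forall_marks_iff (σ : Fin n → ℤ) :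
    (∀ v, 1 ≤ σ v → marks G σ v = 1) ↔
      ∀ c, 1 ≤ c → (∃ v, σ v = c) → ConnectedSet G (Finset.univ.filter fun v => σ v = c) := by
  have hmin : ∀ v, ∃ a, σ a = σ v ∧ ∀ u, σ u = σ v → a ≤ u := by
    intro v
    obtain ⟨a, ha, h⟩ := WellFounded.has_min (wellFounded_lt (α := Fin n))
      {u | σ u = σ v} ⟨v, rfl⟩
    exact ⟨a, ha, fun u hu => not_lt.1 (h u hu)⟩
  constructor
  · rintro h c hc ⟨v, rfl⟩
    obtain ⟨a, ha, hle⟩ := hmin v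
    refine connectedSet_of_closed (a := a) (by simpa using ha) fun T haT hT x hx => ?_
    have hx' : σ x = σ v := by simpa using hx
    refine marks_sound (a := a) (by rwa [ha]) haT (fun u x hu h1 h2 => ?_) (h x (by omega))
      (hx'.trans ha.symm)
    exact hT u x hu (by simpa using h1.trans ha) (by simpa using h2.trans ha)
  · intro h v hv
    obtain ⟨a, ha, hle⟩ := hmin v
    have hc := h (σ v) hv ⟨v, rfl⟩
    refine hc.mem_of_closed (T := {x | marks G σ x = 1}) (a := a) (by simpa using ha) ?_ ?_
      (by simp)
    · refine iterate_markStep_mono ?_ n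
      simp only [markInit]
      exact if_pos (by rwa [ha])
    · intro u x hu h1 h2 hux
      refine marks_closed (u := u) hu hux ?_
      simp only [Finset.mem_filter, Finset.mem_univ, true_and] at h1 h2
      rw [h1, h2]

end Search

end Slab

namespace Slab

/-! ### Labellings versus families of sets, and the slab test -/

section Families

variable {n : ℕ} {G : SimpleGraph (Fin n)} {r : ℕ}

/-- The family of the classes `1, …, r` of a labelling. -/
def fam (r : ℕ) (σ : Fin n → ℤ) : Fin r → Finset (Fin n) :=
  fun i => Finset.univ.filter fun v => σ v = (i : ℤ) + 1

@[simp] theorem mem_fam {σ : Fin n → ℤ} {i : Fin r} {v : Fin n} :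
    v ∈ fam r σ i ↔ σ v = (i : ℤ) + 1 := by
  simp [fam]

theorem fam_disjoint (σ : Fin n → ℤ) (i j : Fin r) (h : i ≠ j) :
    Disjoint (fam r σ i) (fam r σ j) := by
  rw [Finset.disjoint_left]
  intro v hi hj
  rw [mem_fam] at hi hj
  exact h (Fin.ext (by omega))

theorem exists_index {z : ℤ} (h1 : 1 ≤ z) (hr : z ≤ r) : ∃ i : Fin r, z = (i : ℤ) + 1 :=
  ⟨⟨(z - 1).toNat, by omega⟩, by simp only; omega⟩

theorem mem_parts {A : Fin r → Finset (Fin n)} {v : Fin n} : v ∈ parts A ↔ ∃ i, v ∈ A i := by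
  simp [parts]

theorem mem_parts_fam {σ : Fin n → ℤ} (hσ : ∀ v, σ v ≤ r) {v : Fin n} :
    v ∈ parts (fam r σ) ↔ 1 ≤ σ v := by
  rw [mem_parts]
  constructor
  · rintro ⟨i, hi⟩
    rw [mem_fam] at hi
    omega
  · intro h
    obtain ⟨i, hi⟩ := exists_index h (hσ v)
    exact ⟨i, mem_fam.2 hi⟩

theorem mem_nbhd {S : Finset (Fin n)} {v : Fin n} :
    v ∈ nbhd G S ↔ v ∉ S ∧ ∃ u ∈ S, G.Adj u v := by
  simp [nbhd]

theorem mem_outerNbhd_fam {σ : Fin n → ℤ} (hσ : ∀ v, σ v ≤ r) {i : Fin r} {x : Fin n} :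
    x ∈ outerNbhd G (fam r σ) i ↔ σ x ≤ 0 ∧ ∃ u, σ u = (i : ℤ) + 1 ∧ G.Adj u x := by
  unfold outerNbhd
  rw [@Finset.mem_sdiff, mem_nbhd, mem_parts_fam hσ]
  simp only [mem_fam]
  constructor
  · rintro ⟨⟨-, h⟩, h'⟩
    exact ⟨by omega, h⟩
  · rintro ⟨h', h⟩
    exact ⟨⟨by omega, h⟩, by omega⟩

theorem label_of_mem {A : Fin r → Finset (Fin n)} (hA : ∀ i j, i ≠ j → Disjoint (A i) (A j))
    {i : Fin r} {v : Fin n} (h : v ∈ A i) : label A v = (i : ℤ) + 1 := by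
  rw [label, Finset.sum_eq_single i]
  · rw [if_pos h]
  · intro j _ hj
    exact if_neg fun h' => Finset.disjoint_left.1 (hA j i hj) h' h
  · simp

theorem label_of_notMem {A : Fin r → Finset (Fin n)} {v : Fin n} (h : ∀ i, v ∉ A i) :
    label A v = 0 :=
  Finset.sum_eq_zero fun i _ => if_neg (h i)

theorem label_eq_iff {A : Fin r → Finset (Fin n)} (hA : ∀ i j, i ≠ j → Disjoint (A i) (A j))
    {i : Fin r} {v : Fin n} : label A v = (i : ℤ) + 1 ↔ v ∈ A i := by
  refine ⟨fun h => ?_, label_of_mem hA⟩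
  by_cases hv : ∃ j, v ∈ A j
  · obtain ⟨j, hj⟩ := hv
    rw [label_of_mem hA hj] at h
    have : j = i := Fin.ext (by omega)
    exact this ▸ hj
  · rw [label_of_notMem (not_exists.1 hv)] at h
    omega

theorem label_bounds {A : Fin r → Finset (Fin n)} (hA : ∀ i j, i ≠ j → Disjoint (A i) (A j))
    (v : Fin n) : 0 ≤ label A v ∧ label A v ≤ r := by
  by_cases hv : ∃ j, v ∈ A j
  · obtain ⟨j, hj⟩ := hv
    rw [label_of_mem hA hj]
    omega
  · rw [label_of_notMem (not_exists.1 hv)]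
    omega

theorem fam_label {A : Fin r → Finset (Fin n)} (hA : ∀ i j, i ≠ j → Disjoint (A i) (A j)) :
    fam r (label A) = A := by
  funext i
  ext v
  rw [mem_fam, label_eq_iff hA]

theorem fam_congr {σ τ : Fin n → ℤ} (h : ∀ v, max (σ v) 0 = max (τ v) 0) :
    fam r σ = fam r τ := by
  funext i
  ext v
  have := h v
  simp only [mem_fam]
  omega

theorem label_fam {σ : Fin n → ℤ} (hσ : ∀ v, σ v ≤ r) (v : Fin n) :
    label (fam r σ) v = max (σ v) 0 := by
  rcases le_or_gt 1 (σ v) with h | h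
  · obtain ⟨i, hi⟩ := exists_index h (hσ v)
    rw [label_of_mem (fam_disjoint σ) (mem_fam.2 hi), hi]
    omega
  · rw [label_of_notMem fun i => by rw [mem_fam]; omega]
    omega

open Classical in
/-- The conditions for a labelling to be a slab with bounds `α` and `β`, in the form in which they
are tested. -/
structure Good (G : SimpleGraph (Fin n)) (r : ℕ) (α β : ℤ) (σ : Fin n → ℤ) : Prop where
  pos : 1 ≤ r
  le : r ≤ n
  nonempty : ∀ i : Fin n, (i : ℤ) + 1 ≤ r → ∃ v, σ v = (i : ℤ) + 1
  conn : ∀ v, 1 ≤ σ v → marks G σ v = 1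
  adj : ∀ u v, G.Adj u v → 1 ≤ σ u → 1 ≤ σ v → σ u ≤ σ v + 1
  consec : ∀ i : Fin n, (i : ℤ) + 2 ≤ r →
    ∃ u v, G.Adj u v ∧ σ u = (i : ℤ) + 1 ∧ σ v = (i : ℤ) + 2
  disj : ∀ x u v, σ x ≤ 0 → G.Adj u x → G.Adj v x → 1 ≤ σ u → 1 ≤ σ v → σ u ≤ σ v
  outer : ∀ x y u v, G.Adj x y → σ x ≤ 0 → σ y ≤ 0 → G.Adj u x → G.Adj v y → 1 ≤ σ u →
    1 ≤ σ v → σ u ≤ σ v + 1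
  card_le : ((Finset.univ.filter fun v => 1 ≤ σ v).card : ℤ) ≤ α
  card_nbhd_le :
    ((Finset.univ.filter fun v => σ v ≤ 0 ∧ ∃ u, G.Adj u v ∧ 1 ≤ σ u).card : ℤ) ≤ β

theorem parts_fam_eq {σ : Fin n → ℤ} (hσ : ∀ v, σ v ≤ r) :
    parts (fam r σ) = Finset.univ.filter fun v => 1 ≤ σ v := by
  ext v
  rw [mem_parts_fam hσ]
  simp

open Classical in
theorem nbhd_parts_fam_eq {σ : Fin n → ℤ} (hσ : ∀ v, σ v ≤ r) :
    nbhd G (parts (fam r σ)) =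
      Finset.univ.filter fun v => σ v ≤ 0 ∧ ∃ u, G.Adj u v ∧ 1 ≤ σ u := by
  ext v
  rw [mem_nbhd]
  simp only [mem_parts_fam hσ, Finset.mem_filter, Finset.mem_univ, true_and, not_le,
    Int.lt_iff_add_one_le, and_comm]
  simp

/-- A closed set meeting part k contains all of it by connectedness, hence meets part k + 1 through
an edge between the two parts. -/
theorem connectedSet_parts {A : Fin r → Finset (Fin n)} (hr : 1 ≤ r)
    (hc : ∀ i, ConnectedSet G (A i)) (hadj : ∀ i j, Consecutive i j → SetsAdj G (A i) (A j)) :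
    ConnectedSet G (parts A) := by
  obtain ⟨a, ha⟩ := (hc ⟨0, hr⟩).nonempty
  have ha : a ∈ A ⟨0, hr⟩ := ha
  refine connectedSet_of_closed (mem_parts.2 ⟨_, ha⟩) fun T haT hT => ?_
  have hcl : ∀ i u v, u ∈ T → u ∈ A i → v ∈ A i → G.Adj u v → v ∈ T :=
    fun i u v h1 h2 h3 => hT u v h1 (mem_parts.2 ⟨i, h2⟩) (mem_parts.2 ⟨i, h3⟩)
  have key : ∀ k (hk : k < r), ∃ b ∈ A ⟨k, hk⟩, b ∈ T := by
    intro k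
    induction k with
    | zero => exact fun _ => ⟨a, ha, haT⟩
    | succ k ih =>
      intro hk
      obtain ⟨b, hb, hbT⟩ := ih (by omega)
      obtain ⟨u, hu, v, hv, huv⟩ := hadj ⟨k, by omega⟩ ⟨k + 1, hk⟩ (by
        simp [Consecutive])
      have huT := (hc _).mem_of_closed hb hbT (hcl _) hu
      exact ⟨v, hv, hT u v huT (mem_parts.2 ⟨_, hu⟩) (mem_parts.2 ⟨_, hv⟩) huv⟩
  intro v hv
  obtain ⟨i, hi⟩ := mem_parts.1 hv
  obtain ⟨b, hb, hbT⟩ := key i i.2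
  exact (hc _).mem_of_closed hb hbT (hcl _) hi

/-- The tests are one-sided inequalities; applying each to a pair in both orders gives |i − j| ≤ 1
or i = j. Connectedness of the union is not tested, since it follows from `connectedSet_parts`. -/
theorem Good.isBoundedSlab {α β : ℤ} {σ : Fin n → ℤ} (hσ : ∀ v, σ v ≤ r)
    (h : Good G r α β σ) : IsBoundedSlab G α β (fam r σ) := by
  have hne : ∀ i : Fin r, ∃ v, σ v = (i : ℤ) + 1 := fun i =>
    h.nonempty ⟨i, i.2.trans_le h.le⟩ (by simp only; omega)
  have hconn : ∀ i, ConnectedSet G (fam r σ i) := fun i =>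
    (forall_marks_iff σ).1 h.conn _ (by omega) (hne i)
  have hadj : ∀ i j : Fin r, Consecutive i j → SetsAdj G (fam r σ i) (fam r σ j) := by
    have one : ∀ i j : Fin r, (j : ℤ) = i + 1 → SetsAdj G (fam r σ i) (fam r σ j) := by
      intro i j hij
      obtain ⟨u, v, huv, hu, hv⟩ := h.consec ⟨i, i.2.trans_le h.le⟩ (by simp only; omega)
      exact ⟨u, mem_fam.2 hu, v, mem_fam.2 (by rw [hv, hij]; simp only; ring), huv⟩
    intro i j hij
    rcases (abs_eq (by norm_num)).1 hij with e | e
    · obtain ⟨u, hu, v, hv, huv⟩ := one j i (by omega)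
      exact ⟨v, hv, u, hu, huv.symm⟩
    · exact one i j (by omega)
  refine ⟨⟨⟨fam_disjoint σ, rfl⟩, connectedSet_parts h.pos hconn hadj, fun i => ?_, hconn,
    fun i j hij => ⟨?_, hadj i j⟩, fun i j hij => ?_, fun i j hij => ?_⟩, ?_, ?_⟩
  · obtain ⟨v, hv⟩ := hne i
    exact ⟨v, mem_fam.2 hv⟩
  · rintro ⟨u, hu, v, hv, huv⟩
    rw [mem_fam] at hu hv
    have h1 := h.adj u v huv (by omega) (by omega)
    have h2 := h.adj v u huv.symm (by omega) (by omega)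
    have h3 : (i : ℕ) ≠ j := fun e => hij (Fin.ext e)
    rw [Consecutive, abs_eq (by norm_num)]
    omega
  · rw [Finset.disjoint_left]
    intro x hi hj
    rw [mem_outerNbhd_fam hσ] at hi hj
    obtain ⟨hx, u, hu, hux⟩ := hi
    obtain ⟨-, v, hv, hvx⟩ := hj
    have h1 := h.disj x u v hx hux hvx (by omega) (by omega)
    have h2 := h.disj x v u hx hvx hux (by omega) (by omega)
    exact hij (Fin.ext (by omega))
  · rintro ⟨x, hx, y, hy, hxy⟩
    rw [mem_outerNbhd_fam hσ] at hx hy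
    obtain ⟨hx, u, hu, hux⟩ := hx
    obtain ⟨hy, v, hv, hvy⟩ := hy
    have h1 := h.outer x y u v hxy hx hy hux hvy (by omega) (by omega)
    have h2 := h.outer y x v u hxy.symm hy hx hvy hux (by omega) (by omega)
    have h3 : (i : ℕ) ≠ j := fun e => hij (Fin.ext e)
    rw [Consecutive, abs_eq (by norm_num)]
    omega
  · rw [parts_fam_eq hσ]
    exact h.card_le
  · rw [nbhd_parts_fam_eq hσ]
    exact h.card_nbhd_le

theorem IsSlab.one_le {A : Fin r → Finset (Fin n)} (h : IsSlab G A) : 1 ≤ r := by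
  obtain ⟨v, hv⟩ := h.connected.nonempty
  obtain ⟨i, -⟩ := mem_parts.1 hv
  exact i.pos

/-- Choosing one vertex from each of the disjoint parts is injective. This is what allows part
numbers to be searched by loops of length n. -/
theorem IsSlab.le {A : Fin r → Finset (Fin n)} (h : IsSlab G A) : r ≤ n := by
  choose f hf using h.part_nonempty
  have : Function.Injective f := by
    intro i j hij
    by_contra hne
    exact Finset.disjoint_left.1 (h.partition.1 i j hne) (hf i) (hij ▸ hf j)
  simpa using Fintype.card_le_of_injective f this

theorem IsSlab.consecutive_or_eq {A : Fin r → Finset (Fin n)} (h : IsSlab G A) {i j : Fin r}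
    {u v : Fin n} (hu : u ∈ A i) (hv : v ∈ A j) (huv : G.Adj u v) :
    |(i : ℤ) - (j : ℤ)| ≤ 1 := by
  by_cases hij : i = j
  · simp [hij]
  · exact ((h.adj_iff i j hij).1 ⟨u, hu, v, hv, huv⟩).le

theorem IsBoundedSlab.good {α β : ℤ} {σ : Fin n → ℤ} (hσ : ∀ v, σ v ≤ r)
    (h : IsBoundedSlab G α β (fam r σ)) : Good G r α β σ := by
  obtain ⟨h, hα, hβ⟩ := h
  have hc : ∀ {i j : Fin r}, Consecutive i j → |(i : ℤ) - (j : ℤ)| ≤ 1 := fun h => le_of_eq h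
  refine ⟨h.one_le, h.le, fun i hi => ?_, ?_, fun u v huv hu hv => ?_, fun i hi => ?_,
    fun x u v hx hux hvx hu hv => ?_, fun x y u v hxy hx hy hux hvy hu hv => ?_, ?_, ?_⟩
  · obtain ⟨v, hv⟩ := h.part_nonempty ⟨i, by omega⟩
    exact ⟨v, mem_fam.1 hv⟩
  · rw [forall_marks_iff]
    rintro c hc ⟨v, hv⟩
    obtain ⟨i, hi⟩ := exists_index (r := r) hc (hv ▸ hσ v)
    have := h.part_connected i
    rwa [fam, ← hi] at this
  · obtain ⟨i, hi⟩ := exists_index hu (hσ u)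
    obtain ⟨j, hj⟩ := exists_index hv (hσ v)
    have := h.consecutive_or_eq (mem_fam.2 hi) (mem_fam.2 hj) huv
    rw [abs_le] at this
    omega
  · obtain ⟨u, hu, v, hv, huv⟩ := (h.adj_iff ⟨i, by omega⟩ ⟨i + 1, by omega⟩
      (by simp)).2 (by simp [Consecutive])
    rw [mem_fam] at hu hv
    refine ⟨u, v, huv, hu, ?_⟩
    simp only [Nat.cast_add, Nat.cast_one] at hv
    omega
  · obtain ⟨i, hi⟩ := exists_index hu (hσ u)
    obtain ⟨j, hj⟩ := exists_index hv (hσ v)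
    by_cases hij : i = j
    · subst hij; omega
    · exact absurd ((mem_outerNbhd_fam hσ).2 ⟨hx, v, hj, hvx⟩)
        (Finset.disjoint_left.1 (h.outer_disjoint i j hij)
          ((mem_outerNbhd_fam hσ).2 ⟨hx, u, hi, hux⟩))
  · obtain ⟨i, hi⟩ := exists_index hu (hσ u)
    obtain ⟨j, hj⟩ := exists_index hv (hσ v)
    by_cases hij : i = j
    · subst hij; omega
    · have := hc (h.outer_adj i j hij ⟨x, (mem_outerNbhd_fam hσ).2 ⟨hx, u, hi, hux⟩, y,
        (mem_outerNbhd_fam hσ).2 ⟨hy, v, hj, hvy⟩, hxy⟩)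
      rw [abs_le] at this
      omega
  · rwa [parts_fam_eq hσ] at hα
  · rwa [nbhd_parts_fam_eq hσ] at hβ

theorem IsSlab.isTarget {A : Fin r → Finset (Fin n)} (h : IsSlab G A) :
    IsTarget G r (label A) := by
  have hA := h.partition.1
  have hidx : ∀ v, 1 ≤ label A v → ∃ i : Fin r, label A v = (i : ℤ) + 1 ∧ v ∈ A i := by
    intro v hv
    obtain ⟨i, hi⟩ := exists_index hv (label_bounds hA v).2
    exact ⟨i, hi, (label_eq_iff hA).1 hi⟩
  have hpos : ∀ v, v ∈ parts A → 1 ≤ label A v := by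
    intro v hv
    obtain ⟨i, hi⟩ := mem_parts.1 hv
    rw [label_of_mem hA hi]
    omega
  refine ⟨h.le, fun v => (label_bounds hA v).1, fun v => (label_bounds hA v).2,
    fun u v huv hu hv => ?_, fun T a ha haT hT v hv => ?_⟩
  · obtain ⟨i, hi, hui⟩ := hidx u hu
    obtain ⟨j, hj, hvj⟩ := hidx v hv
    have := h.consecutive_or_eq hui hvj huv
    rw [hi, hj]
    convert this using 2
    ring
  · obtain ⟨i, -, hi⟩ := hidx a ha
    obtain ⟨j, -, hj⟩ := hidx v hv
    exact h.connected.mem_of_closed (mem_parts.2 ⟨i, hi⟩) haT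
      (fun u v hu huA hvA huv => hT u v hu (hpos u huA) (hpos v hvA) huv) (mem_parts.2 ⟨j, hj⟩)

/-! ### The results of the branching process -/

/-- The configuration after following the decisions `w`. -/
noncomputable def search (G : SimpleGraph (Fin n)) (r D : ℕ) (lab : Fin n → ℤ) (w : ℕ) :
    Config n :=
  (step G r (4 ^ D))^[D] ⟨w, 1, lab⟩

/-- For P = 4^D and D steps, `rem_close_of_result_eq` reads 4^D · |w − w'| < 4^D. -/
theorem search_inj {D w w' : ℕ} {lab : Fin n → ℤ} (hw : w < 4 ^ D) (hw' : w' < 4 ^ D)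
    (hok : (search G r D lab w).ok = 1) (hok' : (search G r D lab w').ok = 1)
    (hσ : ∀ v, (search G r D lab w).σ v ≤ r) (hσ' : ∀ v, (search G r D lab w').σ v ≤ r)
    (h : fam r (search G r D lab w).σ = fam r (search G r D lab w').σ) : w = w' := by
  have := rem_close_of_result_eq (G := G) (r := r) (P := 4 ^ D) (j := D) (X := ⟨w, 1, lab⟩)
    (X' := ⟨w', 1, lab⟩) rfl (by positivity) (by simp only; exact_mod_cast hw)
    (by positivity) (by simp only; exact_mod_cast hw') hok hok' (fun v => by
      have h1 := label_fam hσ v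
      rw [h, label_fam hσ' v] at h1
      exact h1.symm)
  simp only at this
  have hp : (0 : ℤ) < 4 ^ D := by positivity
  have h1 : |(w : ℤ) - w'| < 1 := by
    by_contra hlt
    nlinarith
  have := Int.abs_lt_one_iff.1 h1
  omega

/-- Initially, the undecided vertices that matter lie in (A \ Q) ∪ N(A), where Q is the union of the
P i. Trivially there are at most n of them, which covers the case that D is capped at n. -/
theorem exists_search {A P : Fin r → Finset (Fin n)} (hA : IsSlab G A) (hPA : ∀ i, P i ⊆ A i)
    (hne : (parts P).Nonempty) {D : ℕ}
    (hD : n ≤ D ∨ ((parts A).card : ℤ) - (parts P).card + (nbhd G (parts A)).card ≤ D) :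
    ∃ w < 4 ^ D, (search G r D (label P) w).ok = 1 ∧
      fam r (search G r D (label P) w).σ = A := by
  classical
  have hdA := hA.partition.1
  have hdP : ∀ i j, i ≠ j → Disjoint (P i) (P j) := fun i j hij =>
    Finset.disjoint_of_subset_left (hPA i) (Finset.disjoint_of_subset_right (hPA j)
      (hdA i j hij))
  have hb := label_bounds hdP
  have hpos : ∀ v, 1 ≤ label P v → ∃ i : Fin r, label P v = (i : ℤ) + 1 ∧ v ∈ P i := by
    intro v hv
    obtain ⟨i, hi⟩ := exists_index hv (hb v).2
    exact ⟨i, hi, (label_eq_iff hdP).1 hi⟩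
  have hagr : Agrees (label P) (label A) := by
    refine ⟨fun v hv => ?_, fun v hv => ?_, ?_⟩
    · obtain ⟨i, hi, hvi⟩ := hpos v hv
      rw [hi, label_of_mem hdA (hPA i hvi)]
    · have := (hb v).1
      omega
    · obtain ⟨a, ha⟩ := hne
      obtain ⟨i, hi⟩ := mem_parts.1 ha
      exact ⟨a, by rw [label_of_mem hdP hi]; omega⟩
  have hPA' : parts P ⊆ parts A := by
    intro v hv
    obtain ⟨i, hi⟩ := mem_parts.1 hv
    exact mem_parts.2 ⟨i, hPA i hi⟩
  have hcard : (undecided G (label P) (label A)).card ≤ D := by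
    rcases hD with hD | hD
    · exact ((Finset.card_le_univ _).trans (by simp)).trans hD
    · have hsub : undecided G (label P) (label A) ⊆
          (parts A \ parts P) ∪ nbhd G (parts A) := by
        intro v hv
        simp only [undecided, Finset.mem_filter, Finset.mem_univ, true_and] at hv
        rw [Finset.mem_union, Finset.mem_sdiff, mem_nbhd]
        have memA : ∀ u, 1 ≤ label A u → u ∈ parts A := by
          intro u hu
          obtain ⟨i, hi⟩ := exists_index hu (label_bounds hdA u).2
          exact mem_parts.2 ⟨i, (label_eq_iff hdA).1 hi⟩
        by_cases hvA : v ∈ parts A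
        · refine .inl ⟨hvA, fun hvP => ?_⟩
          obtain ⟨i, hi⟩ := mem_parts.1 hvP
          have := label_of_mem hdP hi
          omega
        · rcases hv.2 with h | ⟨u, huv, hu⟩
          · exact absurd (memA v h) hvA
          · exact .inr ⟨hvA, u, memA u hu, huv⟩
      have h1 := (Finset.card_le_card hsub).trans (Finset.card_union_le _ _)
      rw [Finset.card_sdiff_of_subset hPA'] at h1
      have h2 := Finset.card_le_card hPA'
      omega
  obtain ⟨y, hy0, hy, hok, hres⟩ := exists_decisions hA.isTarget D _ hagr hcard 1 one_pos
  lift y to ℕ using hy0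
  rw [one_mul, one_mul] at hok hres
  refine ⟨y, by exact_mod_cast hy, hok, ?_⟩
  rw [← fam_label hdA]
  refine fam_congr fun v => ?_
  have h0 := hA.isTarget.nonneg v
  have h1 := hres v
  simp only [search]
  rw [h1]
  omega

end Families

end Slab

namespace Slab

/-! ### The program

Registers: 0–3 input, 4 the number of decisions, 5 the modulus, 6 the decision sequence, 7 and 8 the
fields `rem` and `ok` of the configuration, 9–12 the digit, the picked vertex, the neighbouring part
and the new value, 13 a lower bound for the first part, 14 and 15 loop counters. The other
registers are bound variables. -/

open Term

/-- The entry of the label array at a given index. -/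
def sigAt (m : ℤ → ℤ) (z : ℤ) : ℤ := m (-1 - z - z)

/-- The entry of the mark array at a given index. -/
def markAt (m : ℤ → ℤ) (z : ℤ) : ℤ := m (-2 - z - z)

/-- The label array. -/
def sigOf (n : ℕ) (m : ℤ → ℤ) : Fin n → ℤ := fun v => sigAt m (v : ℕ)

/-- The mark array. -/
def markOf (n : ℕ) (m : ℤ → ℤ) : Fin n → ℤ := fun v => markAt m (v : ℕ)

/-- Adjacency as read from the memory. -/
def AdjAt (n : ℕ) (m : ℤ → ℤ) (N x y : ℤ) : Prop :=
  1 ≤ m (y + ∑ j : Fin n, if ((j : ℕ) : ℤ) ≤ x then N else 0)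

/-- The address of an entry of the label array. -/
def sigAddr (x : ℕ) : Term := .sub (.sub (.const (-1)) (.var x)) (.var x)

/-- The address of an entry of the mark array. -/
def markAddr (x : ℕ) : Term := .sub (.sub (.const (-2)) (.var x)) (.var x)

/-- An entry of the label array. -/
def sigT (x : ℕ) : Term := .load (sigAddr x)

/-- An entry of the mark array. -/
def markT (x : ℕ) : Term := .load (markAddr x)

/-- Adjacency of two vertices. -/
def adjT (x y : ℕ) : Term :=
  leT (.const 1) (.load (.add (.var y) (.sum 31 (.ite (.var 31) (.var x) (.var 0) (.const 0)))))

section Terms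

variable {n : ℕ} {m : ℤ → ℤ} {ρ : ℕ → ℤ}

@[simp] theorem eval_sigAddr {x : ℕ} : (sigAddr x).eval n m ρ = -1 - ρ x - ρ x := rfl

@[simp] theorem eval_markAddr {x : ℕ} : (markAddr x).eval n m ρ = -2 - ρ x - ρ x := rfl

@[simp] theorem eval_sigT {x : ℕ} : (sigT x).eval n m ρ = sigAt m (ρ x) := rfl

@[simp] theorem eval_markT {x : ℕ} : (markT x).eval n m ρ = markAt m (ρ x) := rfl

theorem tr_adjT {x y : ℕ} (hx : x ≠ 31) :
    (adjT x y).Tr n m ρ ↔ AdjAt n m (ρ 0) (ρ x) (ρ y) := by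
  simp [adjT, AdjAt, Term.eval, hx]

/-- The memory contains the input graph. -/
def HasInput (G : SimpleGraph (Fin n)) (lab : Fin n → ℤ) (m : ℤ → ℤ) : Prop :=
  ∀ a, 0 ≤ a → m a = inputMem G lab a

variable {G : SimpleGraph (Fin n)} {lab : Fin n → ℤ}

/-- The machine cannot multiply, so the row offset n(u + 1) is obtained by adding n once for each of
the u + 1 indices j ≤ u. -/
theorem HasInput.adjAt (h : HasInput G lab m) (u v : Fin n) :
    AdjAt n m n ((u : ℕ) : ℤ) ((v : ℕ) : ℤ) ↔ G.Adj u v := by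
  classical
  have hs : (∑ j : Fin n, if ((j : ℕ) : ℤ) ≤ ((u : ℕ) : ℤ) then (n : ℤ) else 0) =
      (n : ℤ) * ((u : ℕ) + 1) := by
    rw [← Finset.sum_filter, Finset.sum_const, nsmul_eq_mul, mul_comm]
    congr 1
    have : (Finset.univ.filter fun j : Fin n => ((j : ℕ) : ℤ) ≤ ((u : ℕ) : ℤ)) = Finset.Iic u := by
      ext j
      simp
    rw [this, Fin.card_Iic]
    push_cast
    ring
  rw [AdjAt, hs, add_comm, h _ (by positivity), inputMem_adj]
  by_cases huv : G.Adj u v <;> simp [huv]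

/-- The first undecided vertex with a neighbour in one of the parts. -/
def pickT : Term :=
  firstT 16 17 (andT (eqT (sigT 17) (.const 0))
    (exT 18 (andT (adjT 18 17) (leT (.const 1) (sigT 18)))))

/-- The least number of a part adjacent to the vertex in register `10`. -/
def nbrPartT : Term :=
  .add (firstT 16 17 (exT 18 (exT 19 (andT (eqT (.var 19) (.var 10)) (andT (adjT 18 19)
    (eqT (sigT 18) (.add (.var 17) (.const 1)))))))) (.const 1)

/-- The first unmarked vertex with a marked neighbour in its class. -/
def markPickT : Term :=
  firstT 16 17 (andT (notT (eqT (markT 17) (.const 1)))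
    (exT 18 (andT (eqT (markT 18) (.const 1)) (andT (adjT 18 17) (eqT (sigT 18) (sigT 17))))))

/-- Whether the vertex in register `15` is the first one of its class. -/
def firstOfClassT : Term :=
  allT 16 (impT (eqT (sigT 16) (sigT 15)) (leT (.var 15) (.var 16)))

theorem eval_pickT (h : HasInput G lab m) (h0 : ρ 0 = n) :
    pickT.eval n m ρ = pick G (sigOf n m) := by
  refine eval_firstT (by decide) fun i j => ?_
  simp [tr_adjT, h0, h.adjAt, Term.eval, sigOf]

theorem eval_nbrPartT (h : HasInput G lab m) (h0 : ρ 0 = n) :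
    nbrPartT.eval n m ρ = nbrPart G (sigOf n m) (ρ 10) := by
  have : ∀ a b : Term, (Term.add a b).eval n m ρ = a.eval n m ρ + b.eval n m ρ :=
    fun _ _ => rfl
  rw [nbrPartT, this, nbrPart]
  congr 1
  refine eval_firstT (by decide) fun i j => ?_
  simp [tr_adjT, h0, h.adjAt, Term.eval, sigOf]

theorem eval_markPickT (h : HasInput G lab m) (h0 : ρ 0 = n) :
    markPickT.eval n m ρ =
      markPick G (sigOf n m) (markOf n m) := by
  refine eval_firstT (by decide) fun i j => ?_
  simp [tr_adjT, h0, h.adjAt, Term.eval, sigOf, markOf]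

theorem tr_firstOfClassT : firstOfClassT.Tr n m ρ ↔
    ∀ u : Fin n, sigAt m (u : ℕ) = sigAt m (ρ 15) → ρ 15 ≤ (u : ℕ) := by
  simp [firstOfClassT, Term.eval]

/-- Four times register `x`. -/
def fourT (x : ℕ) : Term := .add (.add (.var x) (.var x)) (.add (.var x) (.var x))

/-- The leading digit. -/
def digitT : Term :=
  .ite (.add (.var 5) (.add (.var 5) (.var 5))) (fourT 7) (.const 3)
    (.ite (.add (.var 5) (.var 5)) (fourT 7) (.const 2)
      (.ite (.var 5) (fourT 7) (.const 1) (.const 0)))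

/-- The part of the decision sequence that remains after reading the digit in register `9`. -/
def remT : Term :=
  .sub (fourT 7) (.add (.ite (.const 1) (.var 9) (.var 5) (.const 0))
    (.add (.ite (.const 2) (.var 9) (.var 5) (.const 0))
      (.ite (.const 3) (.var 9) (.var 5) (.const 0))))

/-- The new value of the picked vertex. -/
def newValueT : Term :=
  .ite (.const 1) (.var 9) (.sub (.add (.var 11) (.var 9)) (.const 2)) (.const (-1))

/-- The new value of `ok`. -/
def okT : Term :=
  .ite (.const 1) (orT (leT (.var 9) (.const 0)) (andT (leT (.add (.var 10) (.const 1)) (.var 0))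
    (andT (leT (.const 1) (.var 12)) (leT (.var 12) (.var 1))))) (.var 8) (.const 0)

theorem eval_digitT : digitT.eval n m ρ = digit (ρ 5) (ρ 7) := by
  have h3 : ρ 5 + (ρ 5 + ρ 5) = 3 * ρ 5 := by ring
  have h2 : ρ 5 + ρ 5 = 2 * ρ 5 := by ring
  have h4 : ρ 7 + ρ 7 + (ρ 7 + ρ 7) = 4 * ρ 7 := by ring
  simp only [digitT, fourT, Term.eval, digit, h2, h4]
  rw [← h3, h2]

/-- The product of digit and modulus is a repeated addition: P is added once for each of the
thresholds 1, 2, 3 that the digit reaches. -/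
theorem eval_remT {P x : ℤ} (h : ρ 9 = digit P x) (h5 : ρ 5 = P) (h7 : ρ 7 = x) :
    remT.eval n m ρ = 4 * x - digit P x * P := by
  have h1 := digit_mem P x
  simp only [remT, fourT, Term.eval, h, h5, h7]
  generalize digit P x = d at h1
  obtain ⟨h1, h2⟩ := h1
  interval_cases d <;> norm_num <;> ring

theorem eval_okT : okT.eval n m ρ =
    if ρ 9 ≤ 0 ∨ (ρ 10 + 1 ≤ ρ 0 ∧ 1 ≤ ρ 12 ∧ ρ 12 ≤ ρ 1) then ρ 8 else 0 := by
  have key : (orT (leT (.var 9) (.const 0)) (andT (leT (.add (.var 10) (.const 1)) (.var 0))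
    (andT (leT (.const 1) (.var 12)) (leT (.var 12) (.var 1))))).Tr n m ρ ↔
    (ρ 9 ≤ 0 ∨ (ρ 10 + 1 ≤ ρ 0 ∧ 1 ≤ ρ 12 ∧ ρ 12 ≤ ρ 1)) := by
    simp [Term.eval]
  rw [Term.Tr] at key
  simp only [okT, Term.eval, key]

/-- The conditions for the output of a labelling. -/
def checkT : Term :=
  andT (eqT (.var 8) (.const 1)) <| andT (allT 15 (leT (sigT 15) (.var 1))) <|
  andT (allT 15 (impT (eqT (sigT 15) (.const 1)) (leT (.var 13) (.var 15)))) <|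
  andT (leT (.const 1) (.var 1)) <| andT (leT (.var 1) (.var 0)) <|
  andT (allT 15 (impT (leT (.add (.var 15) (.const 1)) (.var 1))
    (exT 16 (eqT (sigT 16) (.add (.var 15) (.const 1)))))) <|
  andT (allT 15 (impT (leT (.const 1) (sigT 15)) (eqT (markT 15) (.const 1)))) <|
  andT (allT 15 (allT 16 (impT (adjT 15 16) (impT (leT (.const 1) (sigT 15))
    (impT (leT (.const 1) (sigT 16)) (leT (sigT 15) (.add (sigT 16) (.const 1)))))))) <|
  andT (allT 15 (impT (leT (.add (.var 15) (.const 2)) (.var 1))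
    (exT 16 (exT 17 (andT (adjT 16 17) (andT (eqT (sigT 16) (.add (.var 15) (.const 1)))
      (eqT (sigT 17) (.add (.var 15) (.const 2))))))))) <|
  andT (allT 15 (allT 16 (allT 17 (impT (leT (sigT 15) (.const 0)) (impT (adjT 16 15)
    (impT (adjT 17 15) (impT (leT (.const 1) (sigT 16)) (impT (leT (.const 1) (sigT 17))
      (leT (sigT 16) (sigT 17)))))))))) <|
  andT (allT 15 (allT 16 (allT 17 (allT 18 (impT (adjT 15 16) (impT (leT (sigT 15) (.const 0))
    (impT (leT (sigT 16) (.const 0)) (impT (adjT 17 15) (impT (adjT 18 16)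
      (impT (leT (.const 1) (sigT 17)) (impT (leT (.const 1) (sigT 18))
        (leT (sigT 17) (.add (sigT 18) (.const 1)))))))))))))) <|
  andT (leT (countT 15 (leT (.const 1) (sigT 15))) (.var 2))
    (leT (countT 15 (andT (leT (sigT 15) (.const 0))
      (exT 16 (andT (adjT 16 15) (leT (.const 1) (sigT 16)))))) (.var 3))

theorem tr_checkT (h : HasInput G lab m) (h0 : ρ 0 = n) {r : ℕ} (h1 : ρ 1 = r)
    {σ : Fin n → ℤ} (hσ : ∀ v : Fin n, sigAt m (v : ℕ) = σ v)
    (hM : ∀ v : Fin n, markAt m (v : ℕ) = marks G σ v) :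
    checkT.Tr n m ρ ↔ ρ 8 = 1 ∧ (∀ v, σ v ≤ r) ∧ (∀ v, σ v = 1 → ρ 13 ≤ (v : ℕ)) ∧
      Good G r (ρ 2) (ρ 3) σ := by
  classical
  have : Good G r (ρ 2) (ρ 3) σ ↔ _ ∧ _ ∧ _ ∧ _ ∧ _ ∧ _ ∧ _ ∧ _ ∧ _ ∧ _ :=
    ⟨fun ⟨a, b, c, d, e, f, g, h, i, j⟩ => ⟨a, b, c, d, e, f, g, h, i, j⟩,
      fun ⟨a, b, c, d, e, f, g, h, i, j⟩ => ⟨a, b, c, d, e, f, g, h, i, j⟩⟩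
  rw [this]
  simp [checkT, tr_adjT, h0, h1, h.adjAt, Term.eval, hσ, hM, eval_countT]

end Terms

end Slab

/-! ### Processing one decision sequence -/

namespace Slab

open Term Stmt

/-- Copy the initial labels, given by a term for the vertex in register `15`. -/
def initLabels (lab : Term) : Stmt := .forn 15 (.store (sigAddr 15) lab)

/-- One branching decision. -/
def stepS : Stmt :=
  .seq (.assign 9 digitT) <| .seq (.assign 10 pickT) <| .seq (.assign 11 nbrPartT) <|
  .seq (.assign 12 newValueT) <| .seq (.assign 8 okT) <| .seq (.assign 7 remT)
    (.store (sigAddr 10) (.var 12))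

/-- All branching decisions. -/
def searchS : Stmt :=
  .forn 14 (.cond (leT (.add (.var 14) (.const 1)) (.var 4)) stepS .skip)

/-- The marking procedure. -/
def marksS : Stmt :=
  .seq (.forn 15 (.store (markAddr 15) (.ite (.const 1) firstOfClassT (.const 1) (.const 0))))
    (.forn 14 (.seq (.assign 10 markPickT) (.store (markAddr 10) (.const 1))))

/-- Output the labelling if it passes the test. -/
def outputS : Stmt :=
  .cond checkT (.forn 15 (.write (.ite (.const 0) (sigT 15) (sigT 15) (.const 0)))) .skip

/-- Follow one sequence of decisions. -/
def coreS (lab : Term) : Stmt :=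
  .seq (initLabels lab) <| .seq (.assign 7 (.var 6)) <| .seq (.assign 8 (.const 1)) <|
  .seq searchS <| .seq marksS outputS

section Specs

variable {n : ℕ} {G : SimpleGraph (Fin n)} {lab : Fin n → ℤ}

/-- Labels occupy the odd negative addresses and marks the even negative ones, so stores to either
array leave the other array and the input intact. -/
theorem HasInput.update {m : ℤ → ℤ} (h : HasInput G lab m) {a z : ℤ} (ha : a < 0) :
    HasInput G lab (Function.update m a z) := by
  intro b hb
  rw [Function.update_of_ne (by omega), h b hb]

theorem sigOf_update_sig (m : ℤ → ℤ) (v z : ℤ) :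
    sigOf n (Function.update m (-1 - v - v) z) =
      fun y : Fin n => if ((y : ℕ) : ℤ) = v then z else sigOf n m y := by
  funext y
  simp only [sigOf, sigAt]
  by_cases h : ((y : ℕ) : ℤ) = v
  · rw [if_pos h, h, Function.update_self]
  · rw [if_neg h, Function.update_of_ne (by omega)]

theorem sigOf_update_mark (m : ℤ → ℤ) (v z : ℤ) :
    sigOf n (Function.update m (-2 - v - v) z) = sigOf n m := by
  funext y
  simp only [sigOf, sigAt]
  rw [Function.update_of_ne (by omega)]

theorem markOf_update_mark (m : ℤ → ℤ) (v z : ℤ) :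
    markOf n (Function.update m (-2 - v - v) z) =
      fun y : Fin n => if ((y : ℕ) : ℤ) = v then z else markOf n m y := by
  funext y
  simp only [markOf, markAt]
  by_cases h : ((y : ℕ) : ℤ) = v
  · rw [if_pos h, h, Function.update_self]
  · rw [if_neg h, Function.update_of_ne (by omega)]

theorem first_nonneg (p : Fin n → Prop) : 0 ≤ first p := by
  classical
  exact Finset.sum_nonneg fun x _ => by split_ifs <;> simp

/-- The configuration in a state. -/
def State.config (n : ℕ) (s : State) : Config n := ⟨s.reg 7, s.reg 8, sigOf n s.mem⟩

/-- This fills an array. Since the addresses are distinct, later stores do not destroy earlier ones;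
K collects what the stores preserve and what the stored values depend on. -/
theorem forn_store_inv {x : ℕ} {addr : Fin n → ℤ} {a t : Term} {f : Fin n → ℤ}
    (K : State → Prop)
    (hK : ∀ (v : Fin n) (s : State), K s → K { s.setReg x ((v : ℕ) : ℤ) with
      mem := Function.update s.mem (addr v) (f v) })
    (ha : ∀ (v : Fin n) (s : State), s.reg x = (v : ℕ) → a.eval n s.mem s.reg = addr v)
    (ht : ∀ (v : Fin n) (s : State), K s → t.eval n s.mem (s.setReg x ((v : ℕ) : ℤ)).reg = f v)
    (hinj : Function.Injective addr) {s : State} (hs : K s) :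
    K ((forn x (store a t)).den n s) ∧
      ∀ v, ((forn x (store a t)).den n s).mem (addr v) = f v := by
  have := den_forn_inv (n := n) (x := x) (p := store a t) (s := s)
    (fun j s' => K s' ∧ ∀ v : Fin n, (v : ℕ) < j → s'.mem (addr v) = f v)
    ⟨hs, fun v hv => absurd hv (Nat.not_lt_zero _)⟩ (fun j hj s' ⟨h1, h2⟩ => by
      have e : (store a t).den n (s'.setReg x j) = { s'.setReg x j with
          mem := Function.update s'.mem (addr ⟨j, hj⟩) (f ⟨j, hj⟩) } := by
        simp only [den]
        rw [ha ⟨j, hj⟩ (s'.setReg x j) (State.setReg_self _ _ _)]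
        congr 2
        exact ht ⟨j, hj⟩ s' h1
      rw [e]
      refine ⟨hK ⟨j, hj⟩ s' h1, fun v hv => ?_⟩
      simp only
      by_cases hvj : v = ⟨j, hj⟩
      · rw [hvj, Function.update_self]
      · have hne : (v : ℕ) ≠ j := fun h => hvj (Fin.ext h)
        rw [Function.update_of_ne (fun h => hvj (hinj h)), h2 v (by omega)])
  exact ⟨this.1, fun v => this.2 v v.2⟩

theorem den_initLabels {t : Term} {f : Fin n → ℤ} {s : State} (hs : HasInput G lab s.mem)
    (ht : ∀ (v : Fin n) (s' : State), HasInput G lab s'.mem → s'.reg 13 = s.reg 13 →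
      s'.reg 15 = (v : ℕ) → t.eval n s'.mem s'.reg = f v) :
    HasInput G lab ((initLabels t).den n s).mem ∧ sigOf n ((initLabels t).den n s).mem = f := by
  have := forn_store_inv (n := n) (x := 15) (addr := fun v => -1 - ((v : ℕ) : ℤ) - ((v : ℕ) : ℤ))
    (a := sigAddr 15) (t := t) (f := f)
    (fun s' => HasInput G lab s'.mem ∧ s'.reg 13 = s.reg 13) ?_ ?_ ?_ ?_ (s := s) ⟨hs, rfl⟩
  · refine ⟨this.1.1, funext fun v => this.2 v⟩
  · rintro v s' ⟨h1, h2⟩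
    refine ⟨h1.update (by omega), ?_⟩
    rw [← h2]
    exact State.setReg_ne s' ((v : ℕ) : ℤ) (show 13 ≠ 15 by decide)
  · intro v s' h
    rw [eval_sigAddr, h]
  · rintro v s' ⟨h1, h2⟩
    exact ht v (s'.setReg 15 ((v : ℕ) : ℤ)) h1
      ((State.setReg_ne s' ((v : ℕ) : ℤ) (show 13 ≠ 15 by decide)).trans h2) (State.setReg_self _ _ _)
  · intro u v h
    exact Fin.ext (by simp only at h; omega)

/-- The store is carried out even if nothing was picked: it then goes to the cell of index n, which
is outside the label array and has a negative address. -/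
theorem den_stepS {r : ℕ} {P : ℤ} {s : State} (hs : HasInput G lab s.mem) (h0 : s.reg 0 = n)
    (h1 : s.reg 1 = r) (h5 : s.reg 5 = P) :
    HasInput G lab (stepS.den n s).mem ∧ (stepS.den n s).config n = step G r P (s.config n) := by
  have hd : ∀ {m : ℤ → ℤ} {ρ : ℕ → ℤ}, newValueT.eval n m ρ =
      if 1 ≤ ρ 9 then ρ 11 + ρ 9 - 2 else -1 := rfl
  have hrem : ∀ {m : ℤ → ℤ} {ρ : ℕ → ℤ}, ρ 5 = P → ρ 9 = digit P (ρ 7) →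
      remT.eval n m ρ = 4 * ρ 7 - digit P (ρ 7) * P := fun h5 h9 => eval_remT h9 h5 rfl
  have hpn : 0 ≤ pick G (sigOf n s.mem) := first_nonneg _
  have e : (stepS.den n s).mem = Function.update s.mem
      (-1 - pick G (sigOf n s.mem) - pick G (sigOf n s.mem))
      (newValue G P (s.config n)) := by
    simp [stepS, den, State.setReg, Term.eval, eval_pickT hs, eval_nbrPartT hs, h0, hd,
      eval_digitT, h5, newValue, State.config]
    rfl
  refine ⟨e ▸ hs.update (by omega), ?_⟩
  ext v
  · simp [stepS, den, State.setReg, State.config, step, hrem, h5, eval_digitT]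
  · simp [stepS, den, State.setReg, State.config, step, h5, eval_digitT, eval_okT, eval_pickT hs,
      eval_nbrPartT hs, h0, h1, hd, newValue]
    rfl
  · simp only [State.config, e, sigOf_update_sig, step]
    rfl

/-- The loop always has n rounds, but only the rounds j with j + 1 ≤ D take effect; hence the
minimum, and no step at all for negative D. -/
theorem den_searchS {r : ℕ} {P D : ℤ} {s : State} (hs : HasInput G lab s.mem)
    (h0 : s.reg 0 = n) (h1 : s.reg 1 = r) (h4 : s.reg 4 = D) (h5 : s.reg 5 = P) :
    HasInput G lab (searchS.den n s).mem ∧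
      (searchS.den n s).config n = (step G r P)^[min n D.toNat] (s.config n) := by
  have := den_forn_inv (n := n) (x := 14)
    (p := .cond (leT (.add (.var 14) (.const 1)) (.var 4)) stepS .skip) (s := s)
    (fun j s' => HasInput G lab s'.mem ∧ (s'.reg 0 = n ∧ s'.reg 1 = r ∧ s'.reg 4 = D ∧
      s'.reg 5 = P) ∧ s'.config n = (step G r P)^[min j D.toNat] (s.config n))
    ⟨hs, ⟨h0, h1, h4, h5⟩, by simp⟩ ?_
  · exact ⟨this.1, this.2.2⟩
  · rintro j hj s' ⟨hm, ⟨h0, h1, h4, h5⟩, hc⟩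
    set s₁ := s'.setReg 14 j with hs₁
    have k0 : s₁.reg 0 = n := by rw [hs₁, State.setReg_ne _ _ (by decide), h0]
    have k1 : s₁.reg 1 = r := by rw [hs₁, State.setReg_ne _ _ (by decide), h1]
    have k4 : s₁.reg 4 = D := by rw [hs₁, State.setReg_ne _ _ (by decide), h4]
    have k5 : s₁.reg 5 = P := by rw [hs₁, State.setReg_ne _ _ (by decide), h5]
    have hc₁ : s₁.config n = s'.config n := rfl
    have htest : 1 ≤ (leT (.add (.var 14) (.const 1)) (.var 4)).eval n s₁.mem s₁.reg ↔
        (j : ℤ) + 1 ≤ D := by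
      rw [← Term.Tr, tr_leT]
      have : s₁.reg 14 = j := State.setReg_self _ _ _
      simp only [Term.eval, k4, this]
    simp only [den, htest]
    split_ifs with hj1
    · obtain ⟨g1, g2⟩ := den_stepS (s := s₁) hm k0 k1 k5
      refine ⟨g1, ⟨?_, ?_, ?_, ?_⟩, ?_⟩
      · rwa [den_reg (by decide)]
      · rwa [den_reg (by decide)]
      · rwa [den_reg (by decide)]
      · rwa [den_reg (by decide)]
      · rw [g2, hc₁, hc, ← Function.iterate_succ_apply' (step G r P)]
        congr 2
        omega
    · refine ⟨hm, ⟨k0, k1, k4, k5⟩, ?_⟩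
      rw [hc₁, hc]
      congr 1
      omega

theorem den_marksS {s : State} (hs : HasInput G lab s.mem) (h0 : s.reg 0 = n) :
    HasInput G lab (marksS.den n s).mem ∧ sigOf n (marksS.den n s).mem = sigOf n s.mem ∧
      markOf n (marksS.den n s).mem = marks G (sigOf n s.mem) := by
  set σ := sigOf n s.mem with hσ
  have h1 := forn_store_inv (n := n) (x := 15)
    (addr := fun v => -2 - ((v : ℕ) : ℤ) - ((v : ℕ) : ℤ))
    (a := markAddr 15) (t := .ite (.const 1) firstOfClassT (.const 1) (.const 0))
    (f := markInit σ)
    (fun s' => HasInput G lab s'.mem ∧ sigOf n s'.mem = σ ∧ s'.reg 0 = n) ?_ ?_ ?_ ?_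
    (s := s) ⟨hs, rfl, h0⟩
  · set s₁ := (forn 15 (.store (markAddr 15)
      (.ite (.const 1) firstOfClassT (.const 1) (.const 0)))).den n s with hs₁
    have h2 := den_forn_inv (n := n) (x := 14)
      (p := .seq (.assign 10 markPickT) (.store (markAddr 10) (.const 1))) (s := s₁)
      (fun j s' => HasInput G lab s'.mem ∧ sigOf n s'.mem = σ ∧ s'.reg 0 = n ∧
        markOf n s'.mem = (markStep G σ)^[j] (markInit σ))
      ⟨h1.1.1, h1.1.2.1, h1.1.2.2, funext fun v => h1.2 v⟩ ?_
    · exact ⟨h2.1, h2.2.1, h2.2.2.2⟩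
    · rintro j hj s' ⟨g1, g2, g3, g4⟩
      have g3' : (s'.setReg 14 j).reg 0 = n := by rw [State.setReg_ne _ _ (by decide), g3]
      have hv : markPickT.eval n (s'.setReg 14 j).mem (s'.setReg 14 j).reg =
          markPick G σ ((markStep G σ)^[j] (markInit σ)) := by
        rw [eval_markPickT (G := G) (lab := lab) (m := (s'.setReg 14 j).mem) g1 g3',
          show sigOf n (s'.setReg 14 j).mem = σ from g2, ← g4]
        rfl
      have hmem : ((Stmt.seq (.assign 10 markPickT) (.store (markAddr 10) (.const 1))).den n
          (s'.setReg 14 j)).mem = Function.update s'.mem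
            (-2 - markPick G σ ((markStep G σ)^[j] (markInit σ)) -
              markPick G σ ((markStep G σ)^[j] (markInit σ))) 1 := by
        simp only [den, eval_markAddr, hv, State.setReg_self, Term.eval]
        rfl
      have hnn : 0 ≤ markPick G σ ((markStep G σ)^[j] (markInit σ)) := first_nonneg _
      refine ⟨hmem ▸ g1.update (by omega), ?_, ?_, ?_⟩
      · rw [hmem, sigOf_update_mark, g2]
      · rw [den_reg (by decide), g3']
      · rw [hmem, markOf_update_mark, Function.iterate_succ_apply', g4]
        rfl
  · rintro v s' ⟨g1, g2, g3⟩
    refine ⟨g1.update (by omega), ?_, ?_⟩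
    · simp only
      rw [sigOf_update_mark, g2]
    · rw [← g3]
      exact State.setReg_ne s' ((v : ℕ) : ℤ) (show 0 ≠ 15 by decide)
  · intro v s' h
    rw [eval_markAddr, h]
  · rintro v s' ⟨g1, g2, g3⟩
    have : 1 ≤ firstOfClassT.eval n s'.mem (s'.setReg 15 ((v : ℕ) : ℤ)).reg ↔
        ∀ u, σ u = σ v → v ≤ u := by
      rw [← Term.Tr, tr_firstOfClassT, State.setReg_self, ← g2]
      simp [sigOf]
    simp only [Term.eval, this, markInit]
  · intro u v h
    exact Fin.ext (by simp only at h; omega)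

open Classical in
theorem den_outputS {r : ℕ} {s : State} (hs : HasInput G lab s.mem) (h0 : s.reg 0 = n)
    (h1 : s.reg 1 = r) {σ : Fin n → ℤ} (hσ : sigOf n s.mem = σ)
    (hM : markOf n s.mem = marks G σ) :
    (outputS.den n s).mem = s.mem ∧ (outputS.den n s).out = s.out ++
      if s.reg 8 = 1 ∧ (∀ v, σ v ≤ r) ∧ (∀ v, σ v = 1 → s.reg 13 ≤ (v : ℕ)) ∧
        Good G r (s.reg 2) (s.reg 3) σ then encode (fam r σ) else [] := by
  have hc := tr_checkT hs h0 h1 (fun v => congrFun hσ v) (fun v => congrFun hM v)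
  rw [Term.Tr] at hc
  simp only [outputS, den, hc]
  split_ifs with hcond
  · have := den_forn_inv (n := n) (x := 15)
      (p := .write (.ite (.const 0) (sigT 15) (sigT 15) (.const 0))) (s := s)
      (fun j s' => s'.mem = s.mem ∧ s'.out = s.out ++ (encode (fam r σ)).take j)
      ⟨rfl, by simp⟩ ?_
    · refine ⟨this.1, ?_⟩
      have h2 := this.2
      rwa [List.take_of_length_le (by simp [encode])] at h2
    · rintro j hj s' ⟨g1, g2⟩
      refine ⟨g1, ?_⟩
      have hval : (Term.ite (.const 0) (sigT 15) (sigT 15) (.const 0)).eval n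
          (s'.setReg 15 j).mem (s'.setReg 15 j).reg = label (fam r σ) ⟨j, hj⟩ := by
        have e : sigAt s.mem (j : ℤ) = σ ⟨j, hj⟩ := congrFun hσ ⟨j, hj⟩
        have e' : (s'.setReg 15 j).mem = s.mem := g1
        -- Excluded vertices are negative in memory and must be output as 0.
        rw [label_fam hcond.2.1]
        simp only [Term.eval, eval_sigT, State.setReg_self, e', e]
        split_ifs <;> omega
      have hlen : j < (encode (fam r σ)).length := by simpa [encode] using hj
      simp only [den, hval]
      rw [List.take_succ_eq_append_getElem hlen, ← List.append_assoc, ← g2]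
      simp [encode, State.setReg]
  · simp

open Classical in
/-- The output for one sequence of decisions. -/
noncomputable def result (G : SimpleGraph (Fin n)) (r D : ℕ) (α β v₀ : ℤ) (lab : Fin n → ℤ)
    (w : ℕ) : List (Fin r → Finset (Fin n)) :=
  let X := search G r D lab w
  if X.ok = 1 ∧ (∀ v, X.σ v ≤ r) ∧ (∀ v, X.σ v = 1 → v₀ ≤ (v : ℕ)) ∧ Good G r α β X.σ
  then [fam r X.σ] else []

/-- All labels and marks are written anew, so whatever earlier sequences left at negative addresses
does not matter. For this reason t may depend only on the input and on registers 13 and 15. -/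
theorem den_coreS {t : Term} {r : ℕ} {D : ℤ} {f : Fin n → ℤ} {s : State} {w : ℕ}
    (hs : HasInput G lab s.mem)
    (h0 : s.reg 0 = n) (h1 : s.reg 1 = r) (h4 : s.reg 4 = D) (h5 : s.reg 5 = 4 ^ min n D.toNat)
    (h6 : s.reg 6 = w)
    (ht : ∀ (v : Fin n) (s' : State), HasInput G lab s'.mem → s'.reg 13 = s.reg 13 →
      s'.reg 15 = (v : ℕ) → t.eval n s'.mem s'.reg = f v) :
    HasInput G lab ((coreS t).den n s).mem ∧ ((coreS t).den n s).out = s.out ++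
      (result G r (min n D.toNat) (s.reg 2) (s.reg 3) (s.reg 13) f w).flatMap encode := by
  classical
  obtain ⟨a1, a2⟩ := den_initLabels (G := G) (lab := lab) (t := t) hs ht
  set s₁ := (initLabels t).den n s with hs₁
  have k₁ : ∀ k, k ≠ 15 → s₁.reg k = s.reg k := fun k hk =>
    den_reg (by simp [initLabels, keeps, hk.symm]) s
  have o₁ : s₁.out = s.out := den_out rfl s
  set s₂ := (s₁.setReg 7 w).setReg 8 1 with hs₂
  have e₂ : (Stmt.assign 8 (.const 1)).den n ((Stmt.assign 7 (.var 6)).den n s₁) = s₂ := by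
    simp only [den, Term.eval, k₁ 6 (by decide), h6, hs₂]
  have k₂ : ∀ k, k ≠ 15 → k ≠ 7 → k ≠ 8 → s₂.reg k = s.reg k := by
    intro k h h' h''
    rw [hs₂, State.setReg_ne _ _ h'', State.setReg_ne _ _ h', k₁ k h]
  have c₂ : s₂.config n = ⟨w, 1, f⟩ := by
    ext v
    · rw [State.config, hs₂]
      simp only
      rw [State.setReg_ne _ _ (by decide), State.setReg_self]
    · exact State.setReg_self (s₁.setReg 7 w) 8 1
    · exact congrFun a2 v
  obtain ⟨b1, b2⟩ := den_searchS (G := G) (lab := lab) (s := s₂) (r := r) (D := D)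
    (P := 4 ^ min n D.toNat) a1
    (by rw [k₂ 0 (by decide) (by decide) (by decide), h0])
    (by rw [k₂ 1 (by decide) (by decide) (by decide), h1])
    (by rw [k₂ 4 (by decide) (by decide) (by decide), h4])
    (by rw [k₂ 5 (by decide) (by decide) (by decide), h5])
  rw [c₂, ← search] at b2
  set s₃ := searchS.den n s₂ with hs₃
  have k₃ : ∀ k, searchS.keeps k → k ≠ 15 → k ≠ 7 → k ≠ 8 → s₃.reg k = s.reg k :=
    fun k hk h h' h'' => by rw [hs₃, den_reg hk, k₂ k h h' h'']
  have o₃ : s₃.out = s.out := by rw [hs₃, den_out (by decide)]; exact o₁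
  have h03 : s₃.reg 0 = n := by
    rw [k₃ 0 (by decide) (by decide) (by decide) (by decide), h0]
  obtain ⟨d1, d2, d3⟩ := den_marksS (G := G) (lab := lab) (s := s₃) b1 h03
  set s₄ := marksS.den n s₃ with hs₄
  have k₄ : ∀ k, marksS.keeps k → s₄.reg k = s₃.reg k := fun k hk => den_reg hk s₃
  have o₄ : s₄.out = s.out := by rw [hs₄, den_out (by decide), o₃]
  have hok : s₄.reg 8 = (search G r (min n D.toNat) f w).ok := by
    rw [k₄ 8 (by decide), ← b2]; rfl
  have hσ : sigOf n s₃.mem = (search G r (min n D.toNat) f w).σ := by rw [← b2]; rfl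
  rw [hσ] at d2 d3
  obtain ⟨g1, g2⟩ := den_outputS (G := G) (lab := lab) (r := r) (s := s₄) d1
    (by rw [k₄ 0 (by decide), h03])
    (by rw [k₄ 1 (by decide), k₃ 1 (by decide) (by decide) (by decide) (by decide), h1]) d2 d3
  have e : (coreS t).den n s = outputS.den n s₄ := by
    simp only [coreS, den] at e₂ ⊢
    rw [← hs₁, e₂]
  rw [e]
  refine ⟨g1 ▸ d1, ?_⟩
  rw [g2, o₄, hok, k₄ 2 (by decide), k₄ 3 (by decide), k₄ 13 (by decide),
    k₃ 2 (by decide) (by decide) (by decide) (by decide),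
    k₃ 3 (by decide) (by decide) (by decide) (by decide),
    k₃ 13 (by decide) (by decide) (by decide) (by decide)]
  congr 1
  simp only [result]
  split_ifs <;> simp

end Specs

end Slab

/-! ### The two algorithms -/

namespace Slab

open Term Stmt

/-- Compute the number of decisions and the modulus. -/
def initS (t : Term) : Stmt :=
  .seq (.assign 4 t) <| .seq (.assign 5 (.const 1)) <|
    .forn 14 (.cond (leT (.add (.var 14) (.const 1)) (.var 4)) (.assign 5 (fourT 5)) .skip)

/-- The number of decisions for a given partition. -/
def extendingBoundT : Term :=
  .add (.sub (.var 2) (countT 15 (leT (.const 1) (.load (.var 15))))) (.var 3)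

/-- The number of decisions for a given vertex. -/
def vertexBoundT : Term := .add (.sub (.var 2) (.const 1)) (.var 3)

/-- The labelling that puts the vertex in register `13` into the first part. -/
def singletonT : Term := .ite (.const 1) (eqT (.var 15) (.var 13)) (.const 1) (.const 0)

/-- The algorithm for slabs extending a given partition. -/
def extendingProg : Prog := longLoop (initS extendingBoundT) (coreS (.load (.var 15)))

/-- The algorithm for all slabs. -/
def allProg : Prog := longLoop (initS vertexBoundT) (.forn 13 (coreS singletonT))

variable {n : ℕ} {G : SimpleGraph (Fin n)} {r : ℕ}

/-- The modulus arises by repeated quadrupling. Capping the exponent at n keeps this polynomial, and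
loses nothing as there are at most n vertices to decide. -/
theorem den_initS {t : Term} {D : ℤ} {s : State} (ht : t.eval n s.mem s.reg = D) :
    ((initS t).den n s).mem = s.mem ∧ ((initS t).den n s).reg 4 = D ∧
      ((initS t).den n s).reg 5 = 4 ^ min n D.toNat := by
  have := den_forn_inv (n := n) (x := 14)
    (p := .cond (leT (.add (.var 14) (.const 1)) (.var 4)) (.assign 5 (fourT 5)) .skip)
    (s := (s.setReg 4 D).setReg 5 1)
    (fun j s' => s'.mem = s.mem ∧ s'.reg 4 = D ∧ s'.reg 5 = 4 ^ min j D.toNat)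
    ⟨rfl, by rw [State.setReg_ne _ _ (by decide), State.setReg_self],
      by rw [State.setReg_self]; simp⟩ ?_
  · simp only [initS, den, ht, Term.eval] at this ⊢
    exact this
  · rintro j hj s' ⟨g1, g2, g3⟩
    have k4 : (s'.setReg 14 j).reg 4 = D := by rw [State.setReg_ne _ _ (by decide), g2]
    have k5 : (s'.setReg 14 j).reg 5 = 4 ^ min j D.toNat := by
      rw [State.setReg_ne _ _ (by decide), g3]
    have htest : 1 ≤ (leT (.add (.var 14) (.const 1)) (.var 4)).eval n (s'.setReg 14 j).mem
        (s'.setReg 14 j).reg ↔ (j : ℤ) + 1 ≤ D := by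
      rw [← Term.Tr, tr_leT]
      simp only [Term.eval, k4, State.setReg_self]
    simp only [den, htest]
    split_ifs with hj1
    · refine ⟨g1, by rw [State.setReg_ne _ _ (by decide), k4], ?_⟩
      rw [State.setReg_self]
      simp only [fourT, Term.eval, k5]
      rw [min_eq_left (by omega : j ≤ D.toNat), min_eq_left (by omega : j + 1 ≤ D.toNat)]
      ring
    · refine ⟨g1, k4, ?_⟩
      rw [k5, min_eq_right (by omega : D.toNat ≤ j), min_eq_right (by omega : D.toNat ≤ j + 1)]

/-! ### The sets that are listed -/

theorem mem_result {D w : ℕ} {α β v₀ : ℤ} {lab : Fin n → ℤ} {A : Fin r → Finset (Fin n)} :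
    A ∈ result G r D α β v₀ lab w ↔ ((search G r D lab w).ok = 1 ∧
      (∀ v, (search G r D lab w).σ v ≤ r) ∧
      (∀ v, (search G r D lab w).σ v = 1 → v₀ ≤ (v : ℕ)) ∧
      Good G r α β (search G r D lab w).σ) ∧ A = fam r (search G r D lab w).σ := by
  classical
  simp only [result]
  split_ifs with h
  · rw [List.mem_singleton]
    exact ⟨fun h' => ⟨h, h'⟩, And.right⟩
  · exact ⟨fun h' => absurd h' List.not_mem_nil, fun h' => absurd h'.1 h⟩

theorem nodup_result {D w : ℕ} {α β v₀ : ℤ} {lab : Fin n → ℤ} :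
    (result G r D α β v₀ lab w).Nodup := by
  simp only [result]
  split_ifs <;> simp

theorem result_inj {D w w' : ℕ} {α β v₀ : ℤ} {lab : Fin n → ℤ} {A : Fin r → Finset (Fin n)}
    (hw : w < 4 ^ D) (hw' : w' < 4 ^ D) (h : A ∈ result G r D α β v₀ lab w)
    (h' : A ∈ result G r D α β v₀ lab w') : w = w' := by
  rw [mem_result] at h h'
  exact search_inj hw hw' h.1.1 h'.1.1 h.1.2.1 h'.1.2.1 (h.2.symm.trans h'.2)

theorem mem_of_mem_result {D w : ℕ} {α β v₀ : ℤ} {lab : Fin n → ℤ}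
    {A : Fin r → Finset (Fin n)} (h : A ∈ result G r D α β v₀ lab w) {v : Fin n} {i : Fin r}
    (hv : lab v = (i : ℤ) + 1) : v ∈ A i := by
  rw [mem_result] at h
  rw [h.2, mem_fam]
  have := iterate_step_σ_of_ne (G := G) (r := r) (P := 4 ^ D) (j := D) (X := ⟨w, 1, lab⟩)
    (v := v) (by simp only; omega)
  exact this.trans hv

theorem le_of_mem_result {D w : ℕ} {α β v₀ : ℤ} {lab : Fin n → ℤ}
    {A : Fin r → Finset (Fin n)} (h : A ∈ result G r D α β v₀ lab w) {v : Fin n} {i : Fin r}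
    (hi : (i : ℕ) = 0) (hv : v ∈ A i) : v₀ ≤ (v : ℕ) := by
  rw [mem_result] at h
  rw [h.2, mem_fam, hi] at hv
  exact h.1.2.2.1 v (by simpa using hv)

/-- The condition on v₀ is void for v₀ = 0, as in the first algorithm. In the second one v₀ is the
seed, and the condition makes it the least vertex of the first part. -/
theorem exists_mem_result_iff {P A : Fin r → Finset (Fin n)} {α β v₀ : ℤ} {D : ℕ}
    (hP : ∀ i j, i ≠ j → Disjoint (P i) (P j)) (hne : (parts P).Nonempty)
    (hD : D = min n (α - ((parts P).card : ℤ) + β).toNat) :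
    (∃ w < 4 ^ D, A ∈ result G r D α β v₀ (label P) w) ↔
      IsBoundedSlab G α β A ∧ (∀ i, P i ⊆ A i) ∧
        ∀ i : Fin r, (i : ℕ) = 0 → ∀ v ∈ A i, v₀ ≤ (v : ℕ) := by
  constructor
  · rintro ⟨w, -, h⟩
    refine ⟨?_, fun i v hv => mem_of_mem_result h (label_of_mem hP hv),
      fun i hi v hv => le_of_mem_result h hi hv⟩
    rw [mem_result] at h
    rw [h.2]
    exact h.1.2.2.2.isBoundedSlab h.1.2.1
  · rintro ⟨hA, hPA, hmin⟩
    obtain ⟨hs, hα, hβ⟩ := hA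
    obtain ⟨w, hw, hok, hfam⟩ := exists_search (D := D) hs hPA hne (by omega)
    have hσ : ∀ v, (search G r D (label P) w).σ v ≤ r :=
      iterate_step_σ_le (X := ⟨w, 1, label P⟩) (fun v => (label_bounds hP v).2) hok
    refine ⟨w, hw, mem_result.2 ⟨⟨hok, hσ, fun v hv => ?_, ?_⟩, hfam.symm⟩⟩
    · have hr := hs.one_le
      refine hmin ⟨0, hr⟩ rfl v ?_
      rw [← hfam, mem_fam, hv]
      simp
    · refine IsBoundedSlab.good hσ ?_
      rw [hfam]
      exact ⟨hs, hα, hβ⟩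

/-! ### Correctness of the programs -/

theorem inputState_mem (G : SimpleGraph (Fin n)) (r : ℕ) (lab : Fin n → ℤ) (α β : ℤ) :
    HasInput G lab (inputState G r lab α β).mem := fun _ _ => rfl

theorem longLoop_time {a b D m : ℕ} (h : D ≤ m) :
    a + (2 + (4 ^ D * (b + 9) + 5)) ≤ 4 ^ m * (a + b + 16) := by
  have h1 : 4 ^ D ≤ 4 ^ m := Nat.pow_le_pow_right (by norm_num) h
  have h2 : 1 ≤ 4 ^ m := Nat.one_le_pow _ _ (by norm_num)
  have h3 := Nat.mul_le_mul_right (b + 9) h1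
  have h4 := Nat.mul_le_mul_right (a + 7) h2
  have h5 : 4 ^ m * (a + b + 16) = 4 ^ m * (b + 9) + 4 ^ m * (a + 7) := by ring
  omega

theorem enumeratesInTime_of_runs {p : Prog} {s : State} {S : (Fin r → Finset (Fin n)) → Prop}
    {T T' : ℕ} {L : List (Fin r → Finset (Fin n))}
    (h : Runs p s (fun s' => s'.out = L.flatMap encode) T) (hT : T ≤ T') (hL : L.Nodup)
    (hS : ∀ A, A ∈ L ↔ S A) : EnumeratesInTime p s S T' := by
  obtain ⟨s', t, h1, h2, h3⟩ := h
  exact ⟨s', t, L, h1, h2.trans hT, hL, hS, h3⟩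

theorem extendingProg_runs {P : Fin r → Finset (Fin n)}
    (hP : ∀ i j, i ≠ j → Disjoint (P i) (P j)) {α β : ℤ} {D : ℕ}
    (hD : D = min n (α - ((parts P).card : ℤ) + β).toNat) :
    Runs extendingProg (inputState G r (label P) α β)
      (fun s' => s'.out = ((List.range (4 ^ D)).flatMap
        (result G r D α β 0 (label P))).flatMap encode)
      ((initS extendingBoundT).cost n +
        (2 + (4 ^ D * ((coreS (.load (.var 15))).cost n + 9) + 5))) := by
  classical
  set s := inputState G r (label P) α β with hs
  have hcard : extendingBoundT.eval n s.mem s.reg = α - ((parts P).card : ℤ) + β := by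
    have e : parts P = Finset.univ.filter fun v : Fin n => 1 ≤ label P v := by
      have := parts_fam_eq fun v => (label_bounds hP v).2
      rwa [fam_label hP] at this
    have e2 : (countT 15 (leT (.const 1) (.load (.var 15)))).eval n s.mem s.reg =
        (parts P).card := by
      rw [eval_countT, e]
      simp [Term.eval, hs, inputState, inputMem_label]
    simp only [extendingBoundT, Term.eval, e2]
    simp [hs, inputState]
  obtain ⟨i1, i2, i3⟩ := den_initS hcard
  rw [← hD] at i3
  refine (runs_longLoop (n := n) (N := 4 ^ D) (by decide) (by decide) (by decide) (by decide)
    (s := s) (by simp [hs, inputState]) (by rw [i3]; norm_cast)).mono (fun s' h => ?_) le_rfl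
  rw [h]
  have hreg : ∀ k, (initS extendingBoundT).keeps k →
      ((initS extendingBoundT).den n s).reg k = s.reg k := fun k hk => den_reg hk s
  have := iter_inv (f := fun w s => (coreS (.load (.var 15))).den n (s.setReg 6 w))
    (n := 4 ^ D) (s := (initS extendingBoundT).den n s)
    (fun j s' => HasInput G (label P) s'.mem ∧ (s'.reg 0 = n ∧ s'.reg 1 = r ∧ s'.reg 2 = α ∧
      s'.reg 3 = β ∧ s'.reg 13 = 0) ∧ (s'.reg 4 = α - ((parts P).card : ℤ) + β ∧
      s'.reg 5 = 4 ^ D) ∧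
      s'.out = ((List.range j).flatMap (result G r D α β 0 (label P))).flatMap encode)
    ⟨by rw [i1]; exact inputState_mem _ _ _ _ _, ⟨?_, ?_, ?_, ?_, ?_⟩, ⟨i2, i3⟩, ?_⟩ ?_
  · exact this.2.2.2
  · rw [hreg 0 (by decide)]; simp [hs, inputState]
  · rw [hreg 1 (by decide)]; simp [hs, inputState]
  · rw [hreg 2 (by decide)]; simp [hs, inputState]
  · rw [hreg 3 (by decide)]; simp [hs, inputState]
  · rw [hreg 13 (by decide)]; simp [hs, inputState]
  · rw [den_out (by decide)]; simp [hs, inputState]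
  · rintro w hw s' ⟨hm, ⟨h0, h1, h2, h3, h13⟩, ⟨h4, h5⟩, ho⟩
    have hk : ∀ k, k ≠ 6 → (s'.setReg 6 w).reg k = s'.reg k :=
      fun k hk => State.setReg_ne _ _ hk
    obtain ⟨c1, c2⟩ := den_coreS (G := G) (lab := label P) (t := .load (.var 15)) (r := r)
      (f := label P) (s := s'.setReg 6 w) (w := w) hm (by rw [hk 0 (by decide), h0])
      (by rw [hk 1 (by decide), h1]) (by rw [hk 4 (by decide), h4])
      (by rw [hk 5 (by decide), h5, hD]) (State.setReg_self _ _ _)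
      (fun v s₁ g1 _ g3 => by
        simp only [Term.eval, g3]
        rw [g1 _ (by positivity), inputMem_label])
    refine ⟨c1, ⟨?_, ?_, ?_, ?_, ?_⟩, ⟨?_, ?_⟩, ?_⟩
    · rw [den_reg (by decide), hk 0 (by decide), h0]
    · rw [den_reg (by decide), hk 1 (by decide), h1]
    · rw [den_reg (by decide), hk 2 (by decide), h2]
    · rw [den_reg (by decide), hk 3 (by decide), h3]
    · rw [den_reg (by decide), hk 13 (by decide), h13]
    · rw [den_reg (by decide), hk 4 (by decide), h4]
    · rw [den_reg (by decide), hk 5 (by decide), h5]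
    · rw [c2, hk 2 (by decide), hk 3 (by decide), hk 13 (by decide), h2, h3, h13, ← hD,
        List.range_succ, List.flatMap_append, List.flatMap_append]
      simp only [List.flatMap_singleton]
      rw [← ho]
      rfl

theorem extendingProg_enumerates {Q : Finset (Fin n)} {P : Fin r → Finset (Fin n)}
    (hQ : Q.Nonempty) (hPQ : IsOrderedPartition Q P) (α β : ℤ) :
    EnumeratesInTime extendingProg (inputState G r (label P) α β)
      (IsBoundedExtendingSlab G P α β)
      (4 ^ (α - (Q.card : ℤ) + β).toNat * ((initS extendingBoundT).cost n +
        (coreS (.load (.var 15))).cost n + 16)) := by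
  obtain ⟨hP, rfl⟩ := hPQ
  refine enumeratesInTime_of_runs (extendingProg_runs hP rfl)
    (longLoop_time (min_le_right _ _)) ?_ fun A => ?_
  · rw [List.nodup_flatMap]
    refine ⟨fun _ _ => nodup_result, ?_⟩
    refine List.Pairwise.imp_of_mem ?_ (List.nodup_range)
    intro w w' hw hw' hne A hA hA'
    exact hne (result_inj (List.mem_range.1 hw) (List.mem_range.1 hw') hA hA')
  · simp only [List.mem_flatMap, List.mem_range]
    rw [exists_mem_result_iff hP hQ rfl]
    constructor
    · rintro ⟨hA, hPA, -⟩
      -- Validity comes for free: adjacent vertices of P i and P j lie in A i and A j.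
      exact ⟨hA, fun i j u hu v hv huv => hA.1.consecutive_or_eq (hPA i hu) (hPA j hv) huv,
        hA.1, hPA⟩
    · rintro ⟨hA, -, -, hPA⟩
      exact ⟨hA, hPA, fun _ _ v _ => by positivity⟩

/-- The labelling that puts only `v` into the first part. -/
def singletonLabel (v : Fin n) : Fin n → ℤ := fun u => if u = v then 1 else 0

/-- The results for the `w`-th decision sequence and all vertices. -/
noncomputable def vertexResults (G : SimpleGraph (Fin n)) (r D : ℕ) (α β : ℤ) (w : ℕ) :
    List (Fin r → Finset (Fin n)) :=
  (List.finRange n).flatMap fun v : Fin n => result G r D α β (v : ℕ) (singletonLabel v) w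

theorem allProg_runs {α β : ℤ} {D : ℕ} (hD : D = min n (α - 1 + β).toNat) :
    Runs allProg (inputState G r (fun _ => 0) α β)
      (fun s' => s'.out = ((List.range (4 ^ D)).flatMap
        (vertexResults G r D α β)).flatMap encode)
      ((initS vertexBoundT).cost n +
        (2 + (4 ^ D * ((Stmt.forn 13 (coreS singletonT)).cost n + 9) + 5))) := by
  classical
  set s := inputState G r (fun _ => 0) α β with hs
  have hcard : vertexBoundT.eval n s.mem s.reg = α - 1 + β := by
    simp [vertexBoundT, Term.eval, hs, inputState]
  obtain ⟨i1, i2, i3⟩ := den_initS hcard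
  rw [← hD] at i3
  refine (runs_longLoop (n := n) (N := 4 ^ D) (by decide) (by decide) (by decide) (by decide)
    (s := s) (by simp [hs, inputState]) (by rw [i3]; norm_cast)).mono (fun s' h => ?_) le_rfl
  rw [h]
  have hreg : ∀ k, (initS vertexBoundT).keeps k →
      ((initS vertexBoundT).den n s).reg k = s.reg k := fun k hk => den_reg hk s
  let K : State → Prop := fun s' => HasInput G (fun _ => 0) s'.mem ∧ (s'.reg 0 = n ∧
    s'.reg 1 = r ∧ s'.reg 2 = α ∧ s'.reg 3 = β) ∧ s'.reg 4 = α - 1 + β ∧ s'.reg 5 = 4 ^ D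
  have := iter_inv (f := fun w s => (Stmt.forn 13 (coreS singletonT)).den n (s.setReg 6 w))
    (n := 4 ^ D) (s := (initS vertexBoundT).den n s)
    (fun j s' => K s' ∧
      s'.out = ((List.range j).flatMap (vertexResults G r D α β)).flatMap encode)
    ⟨⟨by rw [i1]; exact inputState_mem _ _ _ _ _, ⟨?_, ?_, ?_, ?_⟩, i2, i3⟩, ?_⟩ ?_
  · exact this.2
  · rw [hreg 0 (by decide)]; simp [hs, inputState]
  · rw [hreg 1 (by decide)]; simp [hs, inputState]
  · rw [hreg 2 (by decide)]; simp [hs, inputState]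
  · rw [hreg 3 (by decide)]; simp [hs, inputState]
  · rw [den_out (by decide)]; simp [hs, inputState]
  · rintro w hw s' ⟨⟨hm, ⟨h0, h1, h2, h3⟩, h4, h5⟩, ho⟩
    have hk : ∀ k, k ≠ 6 → (s'.setReg 6 w).reg k = s'.reg k :=
      fun k hk => State.setReg_ne _ _ hk
    have inner := den_forn_inv (n := n) (x := 13) (p := coreS singletonT) (s := s'.setReg 6 w)
      (fun j s₁ => (K s₁ ∧ s₁.reg 6 = w) ∧ s₁.out = s'.out ++ (((List.finRange n).take j).flatMap
        fun v : Fin n => result G r D α β (v : ℕ) (singletonLabel v) w).flatMap encode)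
      ⟨⟨⟨hm, ⟨by rw [hk 0 (by decide), h0], by rw [hk 1 (by decide), h1],
        by rw [hk 2 (by decide), h2], by rw [hk 3 (by decide), h3]⟩,
        by rw [hk 4 (by decide), h4], by rw [hk 5 (by decide), h5]⟩, State.setReg_self _ _ _⟩,
        by simp [State.setReg]⟩ ?_
    · rw [List.take_of_length_le (by simp)] at inner
      refine ⟨inner.1.1, ?_⟩
      rw [List.range_succ, List.flatMap_append, List.flatMap_append, ← ho]
      simp only [List.flatMap_singleton]
      exact inner.2
    · rintro j hj s₁ ⟨⟨⟨hm, ⟨h0, h1, h2, h3⟩, h4, h5⟩, h6⟩, ho₁⟩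
      have hk : ∀ k, k ≠ 13 → (s₁.setReg 13 j).reg k = s₁.reg k :=
        fun k hk => State.setReg_ne _ _ hk
      obtain ⟨c1, c2⟩ := den_coreS (G := G) (lab := fun _ => 0) (t := singletonT) (r := r)
        (f := singletonLabel ⟨j, hj⟩) (s := s₁.setReg 13 j) (w := w) hm
        (by rw [hk 0 (by decide), h0])
        (by rw [hk 1 (by decide), h1]) (by rw [hk 4 (by decide), h4])
        (by rw [hk 5 (by decide), h5, hD]) (by rw [hk 6 (by decide), h6])
        (fun v s₂ _ g2 g3 => by
          have e : 1 ≤ (eqT (.var 15) (.var 13)).eval n s₂.mem s₂.reg ↔ v = ⟨j, hj⟩ := by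
            rw [← Term.Tr, tr_eqT]
            simp only [Term.eval, g2, g3, State.setReg_self, Fin.ext_iff]
            omega
          simp only [singletonT, Term.eval, e, singletonLabel])
      refine ⟨⟨⟨c1, ⟨?_, ?_, ?_, ?_⟩, ?_, ?_⟩, ?_⟩, ?_⟩
      · rw [den_reg (by decide), hk 0 (by decide), h0]
      · rw [den_reg (by decide), hk 1 (by decide), h1]
      · rw [den_reg (by decide), hk 2 (by decide), h2]
      · rw [den_reg (by decide), hk 3 (by decide), h3]
      · rw [den_reg (by decide), hk 4 (by decide), h4]
      · rw [den_reg (by decide), hk 5 (by decide), h5]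
      · rw [den_reg (by decide), hk 6 (by decide), h6]
      · have hlen : j < (List.finRange n).length := by simpa using hj
        rw [c2, hk 2 (by decide), hk 3 (by decide), State.setReg_self, h2, h3, ← hD,
          List.take_succ_eq_append_getElem hlen, List.flatMap_append, List.flatMap_append,
          ← List.append_assoc, ← ho₁]
        simp [State.setReg]

theorem label_singleton (hr : 1 ≤ r) (v : Fin n) :
    label (fam r (singletonLabel v)) = singletonLabel v := by
  have h : ∀ u, singletonLabel v u ≤ r := by
    intro u
    simp only [singletonLabel]
    split_ifs <;> omega
  funext u
  rw [label_fam h]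
  simp only [singletonLabel]
  split_ifs <;> rfl

/-- A slab is found from the least vertex of its first part as seed. The exponent has α − 1 because
the seed is a single vertex. -/
theorem mem_vertexResults {A : Fin r → Finset (Fin n)} {α β : ℤ} {D : ℕ}
    (hD : D = min n (α - 1 + β).toNat) :
    (∃ w < 4 ^ D, A ∈ vertexResults G r D α β w) ↔ IsBoundedSlab G α β A := by
  simp only [vertexResults, List.mem_flatMap, List.mem_finRange, true_and]
  -- For r = 0 there is no first part to hold a seed, and there are no slabs either, since their
  -- union is non-empty.
  rcases Nat.eq_zero_or_pos r with rfl | hr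
  · constructor
    · rintro ⟨w, -, v, h⟩
      exact absurd (mem_result.1 h).1.2.2.2.pos (by norm_num)
    · intro h
      exact absurd h.1.one_le (by norm_num)
  have hle : ∀ v u : Fin n, singletonLabel v u ≤ r := by
    intro v u
    simp only [singletonLabel]
    split_ifs <;> omega
  have hparts : ∀ v : Fin n, parts (fam r (singletonLabel v)) = {v} := by
    intro v
    ext u
    rw [mem_parts_fam (hle v), singletonLabel]
    split_ifs with h <;> simp [h]
  have key : ∀ v : Fin n,
      (∃ w < 4 ^ D, A ∈ result G r D α β (v : ℕ) (singletonLabel v) w) ↔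
        IsBoundedSlab G α β A ∧ (∀ i, fam r (singletonLabel v) i ⊆ A i) ∧
          ∀ i : Fin r, (i : ℕ) = 0 → ∀ u ∈ A i, ((v : ℕ) : ℤ) ≤ (u : ℕ) := by
    intro v
    have := exists_mem_result_iff (G := G) (P := fam r (singletonLabel v)) (A := A) (α := α)
      (β := β) (v₀ := (v : ℕ)) (D := D) (fam_disjoint _) (by simp [hparts])
      (by rw [hparts, hD]; simp)
    rwa [label_singleton hr] at this
  constructor
  · rintro ⟨w, hw, v, h⟩
    exact ((key v).1 ⟨w, hw, h⟩).1
  · intro h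
    obtain ⟨v, hv, hmin⟩ := WellFounded.has_min (wellFounded_lt (α := Fin n))
      (A ⟨0, hr⟩ : Set (Fin n)) (h.1.part_nonempty _)
    have hsub : ∀ i, fam r (singletonLabel v) i ⊆ A i := by
      intro i u hu
      rw [mem_fam, singletonLabel] at hu
      split_ifs at hu with huv
      · have : i = ⟨0, hr⟩ := Fin.ext (by simp only; omega)
        rw [this, huv]
        exact hv
      · omega
    have hle : ∀ i : Fin r, (i : ℕ) = 0 → ∀ u ∈ A i, ((v : ℕ) : ℤ) ≤ (u : ℕ) := by
      intro i hi u hu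
      obtain rfl : i = ⟨0, hr⟩ := Fin.ext hi
      exact_mod_cast not_lt.1 (hmin u hu)
    obtain ⟨w, hw, hmem⟩ := (key v).2 ⟨h, hsub, hle⟩
    exact ⟨w, hw, v, hmem⟩

/-- Both seeds lie in the first part of A, and each is at most every vertex of that part. -/
theorem vertexResults_vertex_unique {A : Fin r → Finset (Fin n)} {α β : ℤ} {D w w' : ℕ}
    {v v' : Fin n} (h : A ∈ result G r D α β (v : ℕ) (singletonLabel v) w)
    (h' : A ∈ result G r D α β (v' : ℕ) (singletonLabel v') w') : v = v' := by
  have hr := (mem_result.1 h).1.2.2.2.pos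
  have h0 : v ∈ A ⟨0, hr⟩ := mem_of_mem_result h (by simp [singletonLabel])
  have h0' : v' ∈ A ⟨0, hr⟩ := mem_of_mem_result h' (by simp [singletonLabel])
  have h1 := le_of_mem_result h rfl h0'
  have h1' := le_of_mem_result h' rfl h0
  exact Fin.ext (by omega)

theorem allProg_enumerates (α β : ℤ) :
    EnumeratesInTime allProg (inputState G r (fun _ => 0) α β)
      (fun A : Fin r → Finset (Fin n) => IsBoundedSlab G α β A)
      (4 ^ (α + β).toNat * ((initS vertexBoundT).cost n +
        (Stmt.forn 13 (coreS singletonT)).cost n + 16)) := by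
  refine enumeratesInTime_of_runs (allProg_runs rfl) (longLoop_time (by omega)) ?_ fun A => ?_
  · rw [List.nodup_flatMap]
    refine ⟨fun w _ => ?_, ?_⟩
    · rw [vertexResults, List.nodup_flatMap]
      refine ⟨fun _ _ => nodup_result, ?_⟩
      refine List.Pairwise.imp_of_mem ?_ (List.nodup_finRange n)
      intro v v' _ _ hne A hA hA'
      exact hne (vertexResults_vertex_unique hA hA')
    · refine List.Pairwise.imp_of_mem ?_ (List.nodup_range)
      intro w w' hw hw' hne A hA hA'
      simp only [vertexResults, List.mem_flatMap, List.mem_finRange, true_and] at hA hA'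
      obtain ⟨v, hA⟩ := hA
      obtain ⟨v', hA'⟩ := hA'
      -- Decision sequences can be compared only for the same seed, so the seeds are identified
      -- first.
      obtain rfl := vertexResults_vertex_unique hA hA'
      exact hne (result_inj (List.mem_range.1 hw) (List.mem_range.1 hw') hA hA')
  · simp only [List.mem_flatMap, List.mem_range]
    exact mem_vertexResults rfl

theorem EnumeratesInTime.mono {p : Prog} {s : State} {S : (Fin r → Finset (Fin n)) → Prop}
    {T T' : ℕ} (h : EnumeratesInTime p s S T) (hT : T ≤ T') : EnumeratesInTime p s S T' := by
  obtain ⟨s', t, L, h1, h2, h3⟩ := h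
  exact ⟨s', t, L, h1, h2.trans hT, h3⟩

end Slab

theorem lemma3 :
    (∃ (p : Slab.Prog) (C c : ℕ),
      ∀ (n : ℕ) (G : SimpleGraph (Fin n)) (r : ℕ) (Q : Finset (Fin n))
        (P : Fin r → Finset (Fin n)) (α β : ℤ),
        Q.Nonempty → Slab.IsOrderedPartition Q P →
        Slab.EnumeratesInTime p (Slab.inputState G r (Slab.label P) α β)
          (Slab.IsBoundedExtendingSlab G P α β)
          (4 ^ (α - (Q.card : ℤ) + β).toNat * (C * n ^ c))) ∧
    (∃ (p : Slab.Prog) (C c : ℕ),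
      ∀ (n : ℕ) (G : SimpleGraph (Fin n)) (r : ℕ) (α β : ℤ), 1 ≤ n →
        Slab.EnumeratesInTime p (Slab.inputState G r (fun _ => 0) α β)
          (fun A : Fin r → Finset (Fin n) => Slab.IsBoundedSlab G α β A)
          (4 ^ (α + β).toNat * (C * n ^ c))) := by
  constructor
  · obtain ⟨C, c, h⟩ := (((Slab.initS Slab.extendingBoundT).polyBounded_cost.add
      (Slab.coreS (.load (.var 15))).polyBounded_cost).add (Slab.PolyBounded.const 16))
    refine ⟨Slab.extendingProg, C, c, fun n G r Q P α β hQ hP => ?_⟩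
    -- The polynomial bound needs n ≥ 1, which a vertex of Q provides.
    exact (Slab.extendingProg_enumerates hQ hP α β).mono
      (Nat.mul_le_mul_left _ (h n hQ.choose.pos))
  · obtain ⟨C, c, h⟩ := (((Slab.initS Slab.vertexBoundT).polyBounded_cost.add
      (Slab.Stmt.forn 13 (Slab.coreS Slab.singletonT)).polyBounded_cost).add
      (Slab.PolyBounded.const 16))
    refine ⟨Slab.allProg, C, c, fun n G r α β hn => ?_⟩
    exact (Slab.allProg_enumerates α β).mono (Nat.mul_le_mul_left _ (h n hn))
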